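/- A \emph{quasi-operad} (in topological spaces) is a collection of $\mathbb S_n$-spaces $O(n)$, $n\ge 1$, with continuous $\mathbb S$-equivariant compositions $\circ_i:O(m)\times O(n)\to O(m+n-1)$, $1\le i\le m$; it is an \emph{operad} if these are associative. Two quasi-operad structures on the same $\mathbb S_n$-spaces are \emph{homotopy equivalent} ($\sim$) if they are joined by a homotopy of compositions $\circ_i(t)$, $t\in[0,1]$, which is a quasi-operad structure for every $t$. An \emph{equivalence} ($\simeq$) is a morphism of quasi-operads that is an $\mathbb S_n$-equivariant homotopy equivalence in every arity $n$. Given quasi-operads $C,D$ and continuous equivariant maps $(c,d,c')\mapsto c\circ_i^{d}c'$ from $C(m)\times D(m)\times C(n)$ to $C(m+n-1)$ and $(d,c',d')\mapsto d\circ_i^{c'}d'$ from $D(m)\times C(n)\times D(n)$ to $D(m+n-1)$ (in the unital case: such that the pair of the units is a unit, and that perturbing by a unit gives back $\circ_i$), the \emph{bi-crossed product} $C\bowtie D$ is the collection $C(n)\times D(n)$ with the diagonal action and with $(c,d)\circ_i(c',d')=(c\circ_i^{d}c',\,d\circ_i^{c'}d')$. The \emph{semi-direct product} $C\rtimes D$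 has instead $(c,d)\circ_i(c',d')=(c\circ_i^{d}c',\,d\circ_i d')$. A \emph{cactus} with $n$ lobes is a tree-like configuration of $n$ labelled parametrized circles (lobes) in the plane, of arbitrary radii, with a marked point (global zero) on one of them, up to isotopy preserving the incidences. Its perimeter runs once counterclockwise around the configuration, starting at the global zero. It is \emph{spineless} if the parametrization of each lobe starts (local zero) at the point where the perimeter first reaches the lobe, and \emph{normalized} if all radii are $1$. The space $\mathcal Cact^1(n)$ of normalized spineless cacti is the CW complex with one cell $\prod_v|\Delta^{|v|}|$ (the lengths of the arcs of the lobes $v$) for each planar planted bipartite tree with $n$ labelled white vertices, white leaves and black root; faces are glued by contracting arcs of length $0$. The space of spineless cacti is $\mathcal Cact(n)=\mathcal Cact^1(n)\times\mathbb R_{>0}^n$ (radii), that of cacti is $\mathcal Cacti(n)=\mathcal Cact(n)\times(S^1)^n$, the $a$-th coordinate being the position of the local zero of the lobe $a$, measured counterclockwise from the point where the perimeter first reaches this lobe, and $\mathcal Cacti^1(n)\subset\mathcal Cacti(n)$ is the subspace of normalized cacti. The composition $c\circ_i c'$ rescales $c'$ so that its outside circle gets the length of the $i$-th lobe of $c$,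 and identifies the two, global zero with local zero; in the normalized versions one instead first re-parametrizes the $i$-th lobe of $c$ to the length $n$ of the outside circle of $c'$, where $n$ is the number of lobes of $c'$. $\mathcal S^1$ is the operad built on the monoid $S^1$: $\mathcal S^1(n)=(S^1)^n$ and $\theta\circ_i\theta'=(\theta_1,\dots,\theta_{i-1},\theta_i\theta_1',\dots,\theta_i\theta_n',\theta_{i+1},\dots,\theta_m)$. Let $\rho(\theta,C)$ be $C$ with its base point rotated clockwise around the perimeter by $\theta\in S^1$, let $\Delta_C:S^1\to(S^1)^n$ be the orientation reversed (clockwise) perimeter of the spineless cactus $C$, and put $$C\circ_i^{\theta}C'=C\circ_i\rho(\theta_i,C'),\qquad \theta\circ_i^{C'}\theta'=(\theta_1,\dots,\theta_{i-1},\ \Delta_{C'}(\theta_i)\cdot\theta',\ \theta_{i+1},\dots,\theta_m).$$ \textbf{Theorem.} $\mathcal Cacti$, $\mathcal Cact$ and $\mathcal S^1$ are operads, $\mathcal Cacti^1$ and $\mathcal Cact^1$ are quasi-operads, and the twisted compositions above (and their restrictions to normalized spineless cacti) define bi-crossed and semi-direct products. The underlying spineless cactus and the coordinates of the local zeros give isomorphisms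 of quasi-operads, and the bi-crossed products are homotopy equivalent as quasi-operads to the semi-direct products: $$\mathcal Cacti\cong\mathcal Cact\bowtie\mathcal S^1\sim\mathcal Cact\rtimes\mathcal S^1,\qquad \mathcal Cacti^1\cong\mathcal Cact^1\bowtie\mathcal S^1\sim\mathcal Cact^1\rtimes\mathcal S^1.$$ Moreover, $\mathcal Cact^1\bowtie\mathcal S^1$ is homotopy equivalent to $\mathcal Cact\rtimes\mathcal S^1$ in the sense that the compositions of $\mathcal Cact\rtimes\mathcal S^1$ are homotopic through quasi-operad structures to compositions $\gamma$ on the same spaces for which there is an equivalence of quasi-operads $(\mathcal Cact\times\mathcal S^1,\gamma)\simeq\mathcal Cact^1\bowtie\mathcal S^1$. -/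

import Mathlib

open scoped BigOperators

namespace CactusOperad

/-! ## Symmetric collections, quasi-operads and operads -/

/-- A symmetric collection of topological spaces: spaces `O(n)` with an action of the symmetric
group `S_n`.  (That the group acts by continuous maps is part of `IsQuasiOperad`.) -/
structure SymCollection where
  /-- the space of arity `n` -/
  obj : ℕ → Type
  /-- its topology -/
  top : ∀ n, TopologicalSpace (obj n)
  /-- the (left) action of the symmetric group -/
  act : ∀ n, MulAction (Equiv.Perm (Fin n)) (obj n)

attribute [instance] SymCollection.top SymCollection.act

/-- Position of an entry when the `i`-th of `m` slots is replaced by a block of `n` slots: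
the result has `p = m + n - 1` slots.  Slots are numbered from `0`.  A slot `j < i` keeps its
number, the `k`-th slot of the block becomes number `i + k`, a slot `j > i` becomes `j + n - 1`. -/
def slotEquiv {m n p : ℕ} (h : m + n = p + 1) (i : Fin m) :
    {j : Fin m // j ≠ i} ⊕ Fin n ≃ Fin p where
  toFun := Sum.elim
    (fun j => if hj : j.1 < i then ⟨j.1, by omega⟩
      else ⟨j.1 + n - 1, by have := j.1.isLt; have := Fin.val_ne_of_ne j.2; omega⟩)
    (fun k => ⟨i + k, by omega⟩)
  invFun q :=
    if h₁ : q.1 < i then Sum.inl ⟨⟨q.1, by omega⟩, by intro hq; simp [← hq] at h₁⟩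
    else if h₂ : q.1 < i + n then Sum.inr ⟨q.1 - i, by omega⟩
    else Sum.inl ⟨⟨q.1 + 1 - n, by omega⟩, by
      intro hq; have := congrArg Fin.val hq; simp at this; omega⟩
  left_inv := by
    rintro (⟨j, hj⟩ | k)
    · have := Fin.val_ne_of_ne hj
      by_cases hji : j < i
      · simp [hji]
      · have : ¬ (j.1 + n - 1 < i.1) := by omega
        have h3 : ¬ (j.1 + n - 1 < i.1 + n) := by omega
        simp only [Sum.elim_inl, hji, dite_false, this, h3]
        congr 2; ext; simp; omega
    · simp
  right_inv := by
    intro q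
    by_cases h₁ : q.1 < i
    · have h₃ : (⟨q.1, by omega⟩ : Fin m) < i := h₁
      simp [h₁, h₃]
    · by_cases h₂ : q.1 < i + n
      · simp only [h₁, h₂, dite_true, dite_false, Sum.elim_inr]
        ext; simp; omega
      · have : ¬ (q.1 + 1 - n < i.1) := by omega
        simp only [h₁, h₂, dite_false, Sum.elim_inl, Fin.lt_def, this]
        ext; simp; omega

/-- Replace the `i`-th entry of `u` by the block `v`:
`(u_1, …, u_{i-1}, v_1, …, v_n, u_{i+1}, …, u_m)`. -/
def splice {X : Type*} {m n p : ℕ} (h : m + n = p + 1) (i : Fin m) (u : Fin m → X)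
    (v : Fin n → X) : Fin p → X :=
  fun q => Sum.elim (fun j : {j : Fin m // j ≠ i} => u j) v ((slotEquiv h i).symm q)

/-- The permutation `σ ∘_i τ` of `m + n - 1` slots which permutes `m` slots by `σ`, the `i`-th of
which is a block of `n` slots that is permuted by `τ`. -/
def blockPerm {m n p : ℕ} (h : m + n = p + 1) (i : Fin m) (σ : Equiv.Perm (Fin m))
    (τ : Equiv.Perm (Fin n)) : Equiv.Perm (Fin p) :=
  (slotEquiv h i).symm.trans
    ((Equiv.sumCongr (σ.subtypeEquiv (q := fun j => j ≠ σ i) (fun _ => (σ.injective.ne_iff).symm)) τ).trans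
      (slotEquiv h (σ i)))

/-- Partial compositions `∘_i : O(m) × O(n) → O(m + n - 1)`. -/
def Compositions (O : SymCollection) : Type :=
  ∀ ⦃m n p : ℕ⦄, m + n = p + 1 → Fin m → O.obj m → O.obj n → O.obj p

/-- Quasi-operads in topological spaces: continuous partial compositions which are equivariant;
no associativity is required.  `S_n` acts from the left by renaming inputs, so that the input `i`
of `a` is the input `σ i` of `σ • a`. -/
structure IsQuasiOperad (O : SymCollection) (γ : Compositions O) : Prop where
  continuous_act : ∀ (n : ℕ) (σ : Equiv.Perm (Fin n)), Continuous fun a : O.obj n => σ • a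
  continuous_comp : ∀ ⦃m n p : ℕ⦄ (h : m + n = p + 1) (i : Fin m),
    Continuous fun q : O.obj m × O.obj n => γ h i q.1 q.2
  equivariant : ∀ ⦃m n p : ℕ⦄ (h : m + n = p + 1) (i : Fin m) (σ : Equiv.Perm (Fin m))
    (τ : Equiv.Perm (Fin n)) (a : O.obj m) (b : O.obj n),
    γ h (σ i) (σ • a) (τ • b) = blockPerm h i σ τ • γ h i a b

/-- Operads: associative quasi-operads.  `assoc_nested` is the case in which the third operation
is put into an input of the second one, `assoc_parallel` the case in which the second and the
third operation are put into different inputs of the first one. -/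
structure IsOperad (O : SymCollection) (γ : Compositions O) : Prop
    extends IsQuasiOperad O γ where
  assoc_nested : ∀ ⦃k l m p q r : ℕ⦄ (h₁ : k + l = p + 1) (h₂ : p + m = r + 1)
    (h₃ : l + m = q + 1) (h₄ : k + q = r + 1) (i : Fin k) (j : Fin l) (j' : Fin p),
    (j' : ℕ) = i + j → ∀ (a : O.obj k) (b : O.obj l) (c : O.obj m),
    γ h₂ j' (γ h₁ i a b) c = γ h₄ i a (γ h₃ j b c)
  assoc_parallel : ∀ ⦃k l m p q r : ℕ⦄ (h₁ : k + l = p + 1) (h₂ : p + m = r + 1)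
    (h₃ : k + m = q + 1) (h₄ : q + l = r + 1) (i j : Fin k) (j' : Fin p) (i' : Fin q),
    j < i → (j' : ℕ) = j → (i' : ℕ) + 1 = i + m →
    ∀ (a : O.obj k) (b : O.obj l) (c : O.obj m),
    γ h₂ j' (γ h₁ i a b) c = γ h₄ i' (γ h₃ j a c) b

/-- `e` is a unit for the compositions `γ`. -/
def IsOperadUnit {O : SymCollection} (γ : Compositions O) (e : O.obj 1) : Prop :=
  ∀ (n : ℕ) (a : O.obj n), (∀ i : Fin n, γ rfl i a e = a) ∧ γ (Nat.add_comm 1 n) 0 e a = a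

/-- Isomorphisms of quasi-operads: equivariant homeomorphisms which preserve the compositions. -/
structure QuasiOperadIso {O P : SymCollection} (γ : Compositions O) (δ : Compositions P) where
  /-- the homeomorphism of arity `n` -/
  homeo : ∀ n, O.obj n ≃ₜ P.obj n
  map_act : ∀ (n : ℕ) (σ : Equiv.Perm (Fin n)) (a : O.obj n),
    homeo n (σ • a) = σ • homeo n a
  map_comp : ∀ ⦃m n p : ℕ⦄ (h : m + n = p + 1) (i : Fin m) (a : O.obj m) (b : O.obj n),
    homeo p (γ h i a b) = δ h i (homeo m a) (homeo n b)

/-- Two quasi-operad structures on the same collection are homotopy equivalent (through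
quasi-operads): there is a homotopy of compositions which is a quasi-operad at every time. -/
def HomotopyEquivalent {O : SymCollection} (γ γ' : Compositions O) : Prop :=
  ∃ Γ : unitInterval → Compositions O, Γ 0 = γ ∧ Γ 1 = γ' ∧ (∀ t, IsQuasiOperad O (Γ t)) ∧
    ∀ ⦃m n p : ℕ⦄ (h : m + n = p + 1) (i : Fin m),
      Continuous fun q : unitInterval × O.obj m × O.obj n => Γ q.1 h i q.2.1 q.2.2

/-- There is an equivalence of quasi-operads `(O, γ) → (P, δ)`: a morphism of quasi-operads which
is in each arity `n` an `S_n`-equivariant homotopy equivalence. -/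
def HasEquivalence {O P : SymCollection} (γ : Compositions O) (δ : Compositions P) : Prop :=
  ∃ f : ∀ n, C(O.obj n, P.obj n),
    (∀ (n : ℕ) (σ : Equiv.Perm (Fin n)) (a : O.obj n), f n (σ • a) = σ • f n a) ∧
    (∀ ⦃m n p : ℕ⦄ (h : m + n = p + 1) (i : Fin m) (a : O.obj m) (b : O.obj n),
      f p (γ h i a b) = δ h i (f m a) (f n b)) ∧
    ∀ n, ∃ g : C(P.obj n, O.obj n),
      (∀ (σ : Equiv.Perm (Fin n)) (b : P.obj n), g (σ • b) = σ • g b) ∧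
      (∃ H : ContinuousMap.Homotopy (g.comp (f n)) (ContinuousMap.id (O.obj n)),
        ∀ (t : unitInterval) (σ : Equiv.Perm (Fin n)) (a : O.obj n),
          H (t, σ • a) = σ • H (t, a)) ∧
      ∃ K : ContinuousMap.Homotopy ((f n).comp g) (ContinuousMap.id (P.obj n)),
        ∀ (t : unitInterval) (σ : Equiv.Perm (Fin n)) (b : P.obj n),
          K (t, σ • b) = σ • K (t, b)

/-! ## Semi-direct and bi-crossed products -/

/-- The collection `C(n) × D(n)` with the diagonal action. -/
def SymCollection.prod (C D : SymCollection) : SymCollection where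
  obj n := C.obj n × D.obj n
  top _ := inferInstance
  act _ :=
    { smul := fun σ q => (σ • q.1, σ • q.2)
      one_smul := fun q => Prod.ext (one_smul _ q.1) (one_smul _ q.2)
      mul_smul := fun σ τ q => Prod.ext (mul_smul σ τ q.1) (mul_smul σ τ q.2) }

/-- Perturbed compositions `(c, d, c') ↦ c ∘_i^d c'`. -/
def LeftTwist (C D : SymCollection) : Type :=
  ∀ ⦃m n p : ℕ⦄, m + n = p + 1 → Fin m → C.obj m → D.obj m → C.obj n → C.obj p

/-- Perturbed compositions `(d, c', d') ↦ d ∘_i^{c'} d'`. -/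
def RightTwist (C D : SymCollection) : Type :=
  ∀ ⦃m n p : ℕ⦄, m + n = p + 1 → Fin m → D.obj m → C.obj n → D.obj n → D.obj p

/-- The compositions `(c, d) ∘_i (c', d') = (c ∘_i^d c', d ∘_i d')` of the semi-direct product. -/
def semidirectComp {C D : SymCollection} (δ : Compositions D) (L : LeftTwist C D) :
    Compositions (C.prod D) :=
  fun _ _ _ h i a b => (L h i a.1 a.2 b.1, δ h i a.2 b.2)

/-- The compositions `(c, d) ∘_i (c', d') = (c ∘_i^d c', d ∘_i^{c'} d')` of the bi-crossed
product. -/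
def bicrossedComp {C D : SymCollection} (L : LeftTwist C D) (R : RightTwist C D) :
    Compositions (C.prod D) :=
  fun _ _ _ h i a b => (L h i a.1 a.2 b.1, R h i a.2 b.1 b.2)

/-- The maps `c ∘_i^d c'` are continuous, and equivariant for the diagonal action on the first two
arguments and the action on the third. -/
structure IsLeftTwist {C D : SymCollection} (L : LeftTwist C D) : Prop where
  continuous : ∀ ⦃m n p : ℕ⦄ (h : m + n = p + 1) (i : Fin m),
    Continuous fun q : C.obj m × D.obj m × C.obj n => L h i q.1 q.2.1 q.2.2
  equivariant : ∀ ⦃m n p : ℕ⦄ (h : m + n = p + 1) (i : Fin m) (σ : Equiv.Perm (Fin m))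
    (τ : Equiv.Perm (Fin n)) (c : C.obj m) (d : D.obj m) (c' : C.obj n),
    L h (σ i) (σ • c) (σ • d) (τ • c') = blockPerm h i σ τ • L h i c d c'

/-- The maps `d ∘_i^{c'} d'` are continuous, and equivariant for the action on the first argument
and the diagonal action on the last two. -/
structure IsRightTwist {C D : SymCollection} (R : RightTwist C D) : Prop where
  continuous : ∀ ⦃m n p : ℕ⦄ (h : m + n = p + 1) (i : Fin m),
    Continuous fun q : D.obj m × C.obj n × D.obj n => R h i q.1 q.2.1 q.2.2
  equivariant : ∀ ⦃m n p : ℕ⦄ (h : m + n = p + 1) (i : Fin m) (σ : Equiv.Perm (Fin m))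
    (τ : Equiv.Perm (Fin n)) (d : D.obj m) (c' : C.obj n) (d' : D.obj n),
    R h (σ i) (σ • d) (τ • c') (τ • d') = blockPerm h i σ τ • R h i d c' d'

/-- Data defining a semi-direct product of the quasi-operads `(C, γ)` and `(D, δ)`.  If both are
unital, then the pair of the units has to be a unit and the unit of `D` must not perturb. -/
structure IsSemidirectDatum {C D : SymCollection} (γ : Compositions C) (δ : Compositions D)
    (L : LeftTwist C D) : Prop where
  left : IsLeftTwist L
  unital : ∀ (eC : C.obj 1) (eD : D.obj 1), IsOperadUnit γ eC → IsOperadUnit δ eD →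
    IsOperadUnit (semidirectComp δ L) (eC, eD) ∧
    ∀ ⦃n p : ℕ⦄ (h : 1 + n = p + 1) (i : Fin 1) (c : C.obj 1) (c' : C.obj n),
      L h i c eD c' = γ h i c c'

/-- Data defining a bi-crossed product of the quasi-operads `(C, γ)` and `(D, δ)`.  If both are
unital, then the pair of the units has to be a unit and the units must not perturb. -/
structure IsBicrossedDatum {C D : SymCollection} (γ : Compositions C) (δ : Compositions D)
    (L : LeftTwist C D) (R : RightTwist C D) : Prop where
  left : IsLeftTwist L
  right : IsRightTwist R
  unital : ∀ (eC : C.obj 1) (eD : D.obj 1), IsOperadUnit γ eC → IsOperadUnit δ eD →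
    IsOperadUnit (bicrossedComp L R) (eC, eD) ∧
    (∀ ⦃n p : ℕ⦄ (h : 1 + n = p + 1) (i : Fin 1) (c : C.obj 1) (c' : C.obj n),
      L h i c eD c' = γ h i c c') ∧
    ∀ ⦃m p : ℕ⦄ (h : m + 1 = p + 1) (i : Fin m) (d : D.obj m) (d' : D.obj 1),
      R h i d eC d' = δ h i d d'

/-! ## The operad built on a monoid -/

/-- The collection `S(n) = S^n` of a (topological, here additively written) monoid `S`, with the
permutation of the factors. -/
def monoidCollection (S : Type) [TopologicalSpace S] : SymCollection where
  obj n := Fin n → S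
  top _ := inferInstance
  act _ :=
    { smul := fun σ s b => s (σ⁻¹ b)
      one_smul := fun _ => rfl
      mul_smul := fun _ _ _ => rfl }

/-- The compositions `(s_1, …, s_{i-1}, s_i s'_1, …, s_i s'_n, s_{i+1}, …, s_m)` of the operad built
on a monoid, written additively. -/
def monoidComp (S : Type) [TopologicalSpace S] [AddMonoid S] :
    Compositions (monoidCollection S) :=
  fun _ _ _ h i s s' => splice h i s (fun k => s i + s' k)

/-! ## Spineless cacti

Circles of all radii are parametrized by their angle, measured in full turns, that is by
`ℝ / ℤ`; so re-parametrizing a circle to another length does not change the parameter.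
-/

/-- A cactus without spines, with lobes labelled by `Fin n`.  It is recorded by the radii (lengths)
of the lobes and by its perimeter.  The perimeter runs once around the outside circle of length
`R = ∑ r_a`, counterclockwise and starting at the global zero; when the outside angle (in full
turns, in the universal cover) is `x`, then `perim x a` is the angle by which the perimeter has
moved along the lobe `a`, measured from the zero of that lobe, which in a spineless cactus is the
point at which the perimeter reaches this lobe for the first time.  `perim` and the radii
determine the arcs, their cyclic order and their lengths, hence the cactus up to isotopy. -/
@[ext] structure SpinelessCactus (n : ℕ) where
  /-- radii (lengths) of the lobes -/
  radius : Fin n → ℝ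
  /-- angle moved along each lobe -/
  perim : ℝ → Fin n → ℝ
  /-- there is at least one lobe -/
  pos : 0 < n
  radius_pos : ∀ a, 0 < radius a
  perim_zero : ∀ a, perim 0 a = 0
  /-- going around the outside circle once means going around each lobe once -/
  perim_add_one : ∀ x a, perim (x + 1) a = perim x a + 1
  /-- every lobe is run through in its positive sense -/
  mono : ∀ a, Monotone fun x => perim x a
  /-- the outside circle is parametrized proportionally to arc length -/
  arclength : ∀ x, ∑ a, radius a * perim x a = (∑ a, radius a) * x
  /-- the perimeter consists of finitely many arcs, each of which lies on a single lobe -/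
  finite_arcs : ∀ u v : ℝ, ∃ B : Finset ℝ, ∀ x y : ℝ, u ≤ x → x ≤ y → y ≤ v →
    (∀ b ∈ B, ¬ (x < b ∧ b < y)) → ∃ a, ∀ b, b ≠ a → perim x b = perim y b
  /-- tree-like: two different lobes `a`, `b` meet in at most one point, that is, on the outside
  circle arcs of `a` and of `b` do not alternate as `a, b, a, b` -/
  treeLike : ∀ a b : Fin n, a ≠ b → ∀ x₀ x₁ x₂ x₃ x₄ : ℝ, x₄ ≤ x₀ + 1 →
    ¬ (perim x₀ a < perim x₁ a ∧ perim x₁ b < perim x₂ b ∧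
       perim x₂ a < perim x₃ a ∧ perim x₃ b < perim x₄ b)

@[simp] theorem splice_inl {X : Type*} {m n p : ℕ} (h : m + n = p + 1) (i : Fin m) (u : Fin m → X)
    (v : Fin n → X) (j : {j : Fin m // j ≠ i}) :
    splice h i u v (slotEquiv h i (Sum.inl j)) = u j := by
  simp [splice]

@[simp] theorem splice_inr {X : Type*} {m n p : ℕ} (h : m + n = p + 1) (i : Fin m) (u : Fin m → X)
    (v : Fin n → X) (k : Fin n) :
    splice h i u v (slotEquiv h i (Sum.inr k)) = v k := by
  simp [splice]

/-- A statement about all entries of a splice. -/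
theorem forall_slot {m n p : ℕ} (h : m + n = p + 1) (i : Fin m) {P : Fin p → Prop}
    (h₁ : ∀ j, P (slotEquiv h i (Sum.inl j))) (h₂ : ∀ k, P (slotEquiv h i (Sum.inr k))) :
    ∀ q, P q := by
  intro q
  rw [← (slotEquiv h i).apply_symm_apply q]
  rcases (slotEquiv h i).symm q with j | k
  · exact h₁ j
  · exact h₂ k

theorem sum_slot {m n p : ℕ} (h : m + n = p + 1) (i : Fin m) (f : Fin p → ℝ) (u : Fin m → ℝ)
    (v : Fin n → ℝ) (h₁ : ∀ j : {j : Fin m // j ≠ i}, f (slotEquiv h i (Sum.inl j)) = u j)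
    (h₂ : ∀ k, f (slotEquiv h i (Sum.inr k)) = v k) :
    ∑ q, f q = ∑ j, u j - u i + ∑ k, v k := by
  rw [← (slotEquiv h i).sum_comp f, Fintype.sum_sum_type]
  simp only [h₁, h₂]
  have := Fintype.sum_subtype_add_sum_subtype (fun j : Fin m => j ≠ i) u
  have h₃ : ∑ j : {j : Fin m // ¬ j ≠ i}, u j = u i := by
    rw [Finset.sum_subtype (p := fun j => ¬ j ≠ i) {i} (by simp) u |>.symm]
    simp
  linarith

namespace SpinelessCactus

variable {n : ℕ}

theorem total_pos (c : SpinelessCactus n) : 0 < ∑ a, c.radius a :=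
  Finset.sum_pos (fun a _ => c.radius_pos a) ⟨⟨0, c.pos⟩, Finset.mem_univ _⟩

theorem continuous_perim (c : SpinelessCactus n) (a : Fin n) :
    Continuous fun x => c.perim x a := by
  have key : ∀ x y : ℝ, x ≤ y →
      c.perim y a - c.perim x a ≤ (∑ b, c.radius b) / c.radius a * (y - x) := by
    intro x y hxy
    have h₁ : c.radius a * (c.perim y a - c.perim x a) ≤
        ∑ b, c.radius b * (c.perim y b - c.perim x b) :=
      Finset.single_le_sum (f := fun b => c.radius b * (c.perim y b - c.perim x b))
        (fun b _ => mul_nonneg (c.radius_pos b).le (sub_nonneg.mpr (c.mono b hxy)))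
        (Finset.mem_univ a)
    simp only [mul_sub, Finset.sum_sub_distrib, c.arclength] at h₁
    rw [div_mul_eq_mul_div, le_div_iff₀ (c.radius_pos a)]
    linarith
  have hK : 0 ≤ (∑ b, c.radius b) / c.radius a :=
    (div_pos c.total_pos (c.radius_pos a)).le
  refine (LipschitzWith.of_dist_le_mul (K := Real.toNNReal ((∑ b, c.radius b) / c.radius a))
    fun x y => ?_).continuous
  rw [Real.dist_eq, Real.dist_eq, Real.coe_toNNReal _ hK]
  rcases le_total x y with hxy | hxy
  · have h₁ : c.perim x a ≤ c.perim y a := c.mono a hxy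
    rw [abs_sub_comm, abs_sub_comm x y, abs_of_nonneg (sub_nonneg.mpr h₁),
      abs_of_nonneg (sub_nonneg.mpr hxy)]
    exact key x y hxy
  · have h₁ : c.perim y a ≤ c.perim x a := c.mono a hxy
    rw [abs_of_nonneg (sub_nonneg.mpr h₁), abs_of_nonneg (sub_nonneg.mpr hxy)]
    exact key y x hxy

theorem perim_intCast (c : SpinelessCactus n) (k : ℤ) (a : Fin n) : c.perim k a = k := by
  induction k using Int.induction_on with
  | zero => simpa using c.perim_zero a
  | succ k ih => push_cast at ih ⊢; rw [c.perim_add_one, ih]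
  | pred k ih =>
    have := c.perim_add_one (((-(k : ℤ) - 1 : ℤ)) : ℝ) a
    push_cast at ih this ⊢
    rw [show -(k : ℝ) - 1 + 1 = -k by ring, ih] at this
    linarith

/-- Gluing: the outside circle of `c'` is re-parametrized to the length of the `i`-th lobe of `c`
and identified with this lobe, zero with zero; all lobes of `c'` are rescaled accordingly.  So the
lobes of `c` other than the `i`-th are run through as before, and when the perimeter of `c` has
moved by the angle `t` along the `i`-th lobe, then the perimeter of `c'` has been followed up to the
outside angle `t`. -/
noncomputable def glue {m n p : ℕ} (h : m + n = p + 1) (i : Fin m) (c : SpinelessCactus m)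
    (c' : SpinelessCactus n) : SpinelessCactus p where
  radius := splice h i c.radius (fun k => c.radius i / (∑ l, c'.radius l) * c'.radius k)
  perim x := splice h i (c.perim x) (c'.perim (c.perim x i))
  pos := by have := c.pos; have := c'.pos; omega
  radius_pos := by
    refine forall_slot h i (fun j => ?_) (fun k => ?_)
    · simpa using c.radius_pos _
    · simpa using mul_pos (div_pos (c.radius_pos _) c'.total_pos) (c'.radius_pos _)
  perim_zero := by
    refine forall_slot h i (fun j => ?_) (fun k => ?_)
    · simpa using c.perim_zero _
    · simp [c.perim_zero, c'.perim_zero]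
  perim_add_one x := by
    refine forall_slot h i (fun j => ?_) (fun k => ?_)
    · simpa using c.perim_add_one _ _
    · simp [c.perim_add_one, c'.perim_add_one]
  mono := by
    refine forall_slot h i (fun j => ?_) (fun k => ?_)
    · simpa using c.mono _
    · simpa [Function.comp_def] using (c'.mono k).comp (c.mono i)
  arclength x := by
    have hR := c'.total_pos
    rw [sum_slot h i _ (fun j => c.radius j * c.perim x j)
        (fun k => c.radius i / (∑ l, c'.radius l) * (c'.radius k * c'.perim (c.perim x i) k))
        (by simp) (by intro k; simp; ring),
      sum_slot h i _ c.radius (fun k => c.radius i / (∑ l, c'.radius l) * c'.radius k)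
        (by simp) (by simp), ← Finset.mul_sum, ← Finset.mul_sum, c.arclength, c'.arclength]
    field_simp
    ring
  finite_arcs u v := by
    classical
    obtain ⟨B, hB⟩ := c.finite_arcs u v
    obtain ⟨B', hB'⟩ := c'.finite_arcs (c.perim u i) (c.perim v i)
    let f : ℝ → ℝ := Function.invFun fun x => c.perim x i
    have hf : ∀ x b y : ℝ, c.perim x i < b → b < c.perim y i → (∃ z, c.perim z i = b) →
        x < f b ∧ f b < y := by
      intro x b y h₁ h₂ hz
      have hfb : c.perim (f b) i = b := Function.invFun_eq hz
      constructor
      · by_contra! hle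
        have := c.mono i hle
        simp only at this; linarith
      · by_contra! hle
        have := c.mono i hle
        simp only at this; linarith
    have hcont := c.continuous_perim i
    refine ⟨B ∪ B'.image f, fun x y hux hxy hyv hb => ?_⟩
    obtain ⟨a, ha⟩ := hB x y hux hxy hyv
      (fun b hb' => hb b (Finset.mem_union_left _ hb'))
    by_cases hai : a = i
    · subst hai
      obtain ⟨a', ha'⟩ := hB' (c.perim x a) (c.perim y a) (c.mono a hux) (c.mono a hxy)
        (c.mono a hyv) (fun b hb' hlt => by
          have hz : ∃ z, c.perim z a = b :=
            mem_range_of_exists_le_of_exists_ge hcont ⟨x, hlt.1.le⟩ ⟨y, hlt.2.le⟩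
          exact hb (f b) (Finset.mem_union_right _ (Finset.mem_image_of_mem f hb'))
            (hf x b y hlt.1 hlt.2 hz))
      refine ⟨slotEquiv h a (Sum.inr a'), ?_⟩
      refine forall_slot h a (fun j _ => ?_) (fun k hk => ?_)
      · simpa using ha _ j.2
      · simpa using ha' k (fun hk' => hk (by rw [hk']))
    · refine ⟨slotEquiv h i (Sum.inl ⟨a, hai⟩), ?_⟩
      refine forall_slot h i (fun j hj => ?_) (fun k _ => ?_)
      · simpa using ha j (fun hj' => hj (by congr 2; exact Subtype.ext hj'))
      · simp [ha i (Ne.symm hai)]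
  treeLike := by
    have key : ∀ (k : Fin n) (x y : ℝ), c'.perim (c.perim x i) k < c'.perim (c.perim y i) k →
        c.perim x i < c.perim y i := by
      intro k x y hlt
      by_contra! hle
      exact absurd (c'.mono k hle) (not_le.mpr hlt)
    refine forall_slot h i (fun j => ?_) (fun k => ?_)
    · refine forall_slot h i (fun j' hne => ?_) (fun k' _ => ?_)
      · intro x₀ x₁ x₂ x₃ x₄ hx
        simpa using c.treeLike j j' (fun e => hne (by congr 2; exact Subtype.ext e))
          x₀ x₁ x₂ x₃ x₄ hx
      · intro x₀ x₁ x₂ x₃ x₄ hx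
        simp only [splice_inl, splice_inr]
        rintro ⟨h₁, h₂, h₃, h₄⟩
        exact c.treeLike j i j.2 x₀ x₁ x₂ x₃ x₄ hx ⟨h₁, key _ _ _ h₂, h₃, key _ _ _ h₄⟩
    · refine forall_slot h i (fun j' _ => ?_) (fun k' hne => ?_)
      · intro x₀ x₁ x₂ x₃ x₄ hx
        simp only [splice_inl, splice_inr]
        rintro ⟨h₁, h₂, h₃, h₄⟩
        exact c.treeLike i j' (Ne.symm j'.2) x₀ x₁ x₂ x₃ x₄ hx ⟨key _ _ _ h₁, h₂, key _ _ _ h₃, h₄⟩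
      · intro x₀ x₁ x₂ x₃ x₄ hx
        have := c'.treeLike k k' (fun e => hne (by rw [e])) (c.perim x₀ i) (c.perim x₁ i)
          (c.perim x₂ i) (c.perim x₃ i) (c.perim x₄ i)
          (by rw [← c.perim_add_one]; exact c.mono i hx)
        simpa using this

/-- The outside angle after rescaling the lobes to the radii `s`, as a function of the outside
angle before. -/
noncomputable def clock (c : SpinelessCactus n) (s : Fin n → ℝ) (x : ℝ) : ℝ :=
  (∑ a, s a * c.perim x a) / ∑ a, s a

theorem clock_bijective (c : SpinelessCactus n) (s : Fin n → ℝ) (hs : ∀ a, 0 < s a) :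
    StrictMono (c.clock s) ∧ Function.Surjective (c.clock s) := by
  have hS : 0 < ∑ a, s a := Finset.sum_pos (fun a _ => hs a) ⟨⟨0, c.pos⟩, Finset.mem_univ _⟩
  have hmono : StrictMono (c.clock s) := by
    intro x y hxy
    refine div_lt_div_of_pos_right ?_ hS
    refine Finset.sum_lt_sum (fun a _ => mul_le_mul_of_nonneg_left (c.mono a hxy.le) (hs a).le) ?_
    by_contra! hle
    have h₁ : ∑ a, c.radius a * c.perim y a ≤ ∑ a, c.radius a * c.perim x a := by
      refine Finset.sum_le_sum fun a ha => mul_le_mul_of_nonneg_left ?_ (c.radius_pos a).le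
      exact le_of_mul_le_mul_left (hle a ha) (hs a)
    rw [c.arclength, c.arclength] at h₁
    exact absurd (le_of_mul_le_mul_left h₁ c.total_pos) (not_le.mpr hxy)
  refine ⟨hmono, ?_⟩
  have hcont : Continuous (c.clock s) :=
    (continuous_finsetSum _ fun a _ => (continuous_const.mul (c.continuous_perim a))).div_const _
  have hint : ∀ k : ℤ, c.clock s k = k := by
    intro k
    simp only [clock, c.perim_intCast, ← Finset.sum_mul]
    field_simp
  intro y
  exact mem_range_of_exists_le_of_exists_ge hcont
    ⟨⌊y⌋, by rw [hint]; exact Int.floor_le y⟩ ⟨⌈y⌉, by rw [hint]; exact Int.le_ceil y⟩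

/-- The cactus with the same underlying configuration, the lobes being rescaled to the radii
`s`. -/
noncomputable def rescale (c : SpinelessCactus n) (s : Fin n → ℝ) (hs : ∀ a, 0 < s a) :
    SpinelessCactus n :=
  let e : ℝ ≃o ℝ := StrictMono.orderIsoOfSurjective (c.clock s) (c.clock_bijective s hs).1
    (c.clock_bijective s hs).2
  have he : ∀ x, e x = c.clock s x := fun _ => rfl
  have hS : 0 < ∑ a, s a := Finset.sum_pos (fun a _ => hs a) ⟨⟨0, c.pos⟩, Finset.mem_univ _⟩
  have e_add : ∀ x, e.symm (x + 1) = e.symm x + 1 := by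
    intro x
    rw [OrderIso.symm_apply_eq, he]
    have : c.clock s (e.symm x + 1) = c.clock s (e.symm x) + 1 := by
      simp only [clock, c.perim_add_one, mul_add, Finset.sum_add_distrib]
      field_simp
    rw [this, ← he, OrderIso.apply_symm_apply]
  { radius := s
    perim := fun x => c.perim (e.symm x)
    pos := c.pos
    radius_pos := hs
    perim_zero := fun a => by
      have : e.symm 0 = 0 := by
        rw [OrderIso.symm_apply_eq, he]
        simp [clock, c.perim_zero]
      rw [this, c.perim_zero]
    perim_add_one := fun x a => by rw [e_add, c.perim_add_one]
    mono := fun a => (c.mono a).comp e.symm.monotone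
    arclength := fun x => by
      have : c.clock s (e.symm x) = x := by rw [← he, OrderIso.apply_symm_apply]
      rw [clock, div_eq_iff hS.ne'] at this
      rw [this, mul_comm]
    finite_arcs := fun u v => by
      classical
      obtain ⟨B, hB⟩ := c.finite_arcs (e.symm u) (e.symm v)
      refine ⟨B.image e, fun x y hux hxy hyv hb => ?_⟩
      refine hB _ _ (e.symm.monotone hux) (e.symm.monotone hxy) (e.symm.monotone hyv) ?_
      rintro b hbB ⟨h₁, h₂⟩
      exact hb (e b) (Finset.mem_image_of_mem _ hbB)
        ⟨(OrderIso.symm_apply_lt e).mp h₁, (OrderIso.lt_symm_apply e).mp h₂⟩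
    treeLike := fun a b hab x₀ x₁ x₂ x₃ x₄ hx => by
      refine c.treeLike a b hab _ _ _ _ _ ?_
      rw [← e_add]
      exact e.symm.monotone hx }

/-- Moving the base point (the global zero) clockwise along the perimeter by the outside angle `t`
(in full turns). -/
def rotateBy (c : SpinelessCactus n) (t : ℝ) : SpinelessCactus n where
  radius := c.radius
  perim x a := c.perim (x - t) a - c.perim (-t) a
  pos := c.pos
  radius_pos := c.radius_pos
  perim_zero a := by simp
  perim_add_one x a := by
    rw [show x + 1 - t = x - t + 1 by ring, c.perim_add_one]; ring
  mono a x y hxy := by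
    have : c.perim (x - t) a ≤ c.perim (y - t) a := c.mono a (by linarith)
    simp only; linarith
  arclength x := by
    simp only [mul_sub, Finset.sum_sub_distrib, c.arclength]; ring
  finite_arcs u v := by
    classical
    obtain ⟨B, hB⟩ := c.finite_arcs (u - t) (v - t)
    refine ⟨B.image (· + t), fun x y hux hxy hyv hb => ?_⟩
    obtain ⟨a, ha⟩ := hB (x - t) (y - t) (by linarith) (by linarith) (by linarith) (by
      rintro b hbB ⟨h₁, h₂⟩
      exact hb (b + t) (Finset.mem_image_of_mem _ hbB) ⟨by linarith, by linarith⟩)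
    exact ⟨a, fun b hb => by rw [ha b hb]⟩
  treeLike a b hab x₀ x₁ x₂ x₃ x₄ hx := by
    simpa using c.treeLike a b hab (x₀ - t) (x₁ - t) (x₂ - t) (x₃ - t) (x₄ - t) (by linarith)

theorem rotateBy_periodic (c : SpinelessCactus n) : Function.Periodic c.rotateBy 1 := by
  intro t
  ext x a
  · rfl
  · have h₁ := c.perim_add_one (x - (t + 1)) a
    have h₂ := c.perim_add_one (-(t + 1)) a
    rw [show x - (t + 1) + 1 = x - t by ring] at h₁
    rw [show -(t + 1) + 1 = -t by ring] at h₂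
    simp only [rotateBy, h₁, h₂]; ring

/-- The action of the circle `ℝ / ℤ` on spineless cacti by rotating the base point clockwise
around the perimeter. -/
def rotate (θ : UnitAddCircle) (c : SpinelessCactus n) : SpinelessCactus n :=
  c.rotateBy_periodic.lift θ

/-- The perimeter as a map from the outside circle to the product of the lobes. -/
def outer (c : SpinelessCactus n) : UnitAddCircle → Fin n → UnitAddCircle :=
  Function.Periodic.lift (f := fun x a => ((c.perim x a : ℝ) : UnitAddCircle)) (c := 1) (by
    intro x
    funext a
    simp [c.perim_add_one])

/-- The homotopy diagonal `Δ_C : S^1 → (S^1)^n` of a spineless cactus: the orientation reversed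
perimeter. -/
def diagonal (c : SpinelessCactus n) (θ : UnitAddCircle) : Fin n → UnitAddCircle :=
  fun a => -(c.outer (-θ) a)

/-- Renaming the lobes. -/
instance : MulAction (Equiv.Perm (Fin n)) (SpinelessCactus n) where
  smul σ c :=
    { radius := fun b => c.radius (σ⁻¹ b)
      perim := fun x b => c.perim x (σ⁻¹ b)
      pos := c.pos
      radius_pos := fun b => c.radius_pos _
      perim_zero := fun b => c.perim_zero _
      perim_add_one := fun x b => c.perim_add_one x _
      mono := fun b => c.mono _
      arclength := fun x => by
        have h₁ := Equiv.sum_comp σ⁻¹ (fun b => c.radius b * c.perim x b)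
        have h₂ := Equiv.sum_comp σ⁻¹ c.radius
        rw [h₁, h₂]; exact c.arclength x
      finite_arcs := fun u v => by
        obtain ⟨B, hB⟩ := c.finite_arcs u v
        refine ⟨B, fun x y h₁ h₂ h₃ h₄ => ?_⟩
        obtain ⟨a, ha⟩ := hB x y h₁ h₂ h₃ h₄
        exact ⟨σ a, fun b hb => ha _ (fun e => hb (by rw [← e]; simp))⟩
      treeLike := fun a b hab => c.treeLike _ _ (fun e => hab (σ⁻¹.injective e)) }
  one_smul _ := rfl
  mul_smul _ _ _ := rfl

end SpinelessCactus

/-! ## Normalized spineless cacti and the topology -/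

/-- Normalized spineless cacti: all lobes have radius one. -/
def NormalizedSpinelessCactus (n : ℕ) : Type :=
  {c : SpinelessCactus n // ∀ a, c.radius a = 1}

/-- The topological types of spineless cacti with `n` lobes, that is, the planar planted bipartite
trees with white leaves, black root and white vertices labelled by `Fin n`.  Such a tree is
recorded by the sequence of its edges, in the order in which the outside circle runs through the
corresponding arcs, each edge being replaced by the label of its white vertex.  Consecutive arcs lie
on different lobes, every lobe occurs, and, as the graph is a tree, two lobes do not alternate. -/
structure TreeType (n : ℕ) where
  /-- the number of edges -/
  len : ℕ
  /-- the white vertex of an edge -/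
  lobe : Fin len → Fin n
  pos : 0 < n
  surjective : Function.Surjective lobe
  reduced : ∀ j j' : Fin len, (j' : ℕ) = j + 1 → lobe j ≠ lobe j'
  planar : ∀ j₁ j₂ j₃ j₄ : Fin len, j₁ < j₂ → j₂ < j₃ → j₃ < j₄ →
    lobe j₁ = lobe j₃ → lobe j₂ = lobe j₄ → lobe j₁ = lobe j₂

namespace TreeType

variable {n : ℕ}

/-- The closed cell of a tree: the product over the white vertices of the closed simplices of
lengths of the arcs of the corresponding lobe of radius one. -/
def Cell (τ : TreeType n) : Type :=
  {l : Fin τ.len → ℝ // (∀ j, 0 ≤ l j) ∧ ∀ a, ∑ j with τ.lobe j = a, l j = 1}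

instance (τ : TreeType n) : TopologicalSpace τ.Cell := instTopologicalSpaceSubtype

/-- The position on the outside circle at which the `j`-th arc starts (and the one before ends). -/
noncomputable def start (τ : TreeType n) (l : τ.Cell) (j : ℕ) : ℝ :=
  ∑ i with (i : Fin τ.len).val < j, l.1 i

/-- The length travelled along the lobe `a` when the outside circle of length `n` has been followed
from the global zero up to `y`: of the `j`-th arc one has travelled
`min y (start (j + 1)) - min y (start j)`. -/
noncomputable def travelled (τ : TreeType n) (l : τ.Cell) (y : ℝ) (a : Fin n) : ℝ :=
  ∑ j with τ.lobe j = a, (min y (τ.start l (j + 1)) - min y (τ.start l j))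

theorem start_zero (τ : TreeType n) (l : τ.Cell) : τ.start l 0 = 0 := by simp [start]

theorem start_mono (τ : TreeType n) (l : τ.Cell) : Monotone (τ.start l) := by
  intro j k hjk
  refine Finset.sum_le_sum_of_subset_of_nonneg ?_ (fun i _ _ => l.2.1 i)
  intro i hi
  simp only [Finset.mem_filter, Finset.mem_univ, true_and] at hi ⊢
  omega

theorem start_succ (τ : TreeType n) (l : τ.Cell) (j : Fin τ.len) :
    τ.start l (j + 1) = τ.start l j + l.1 j := by
  have : (Finset.univ.filter fun i : Fin τ.len => i.val < j + 1) =
      insert j (Finset.univ.filter fun i : Fin τ.len => i.val < j) := by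
    ext i
    simp only [Finset.mem_filter, Finset.mem_univ, true_and, Finset.mem_insert, Fin.ext_iff]
    omega
  rw [start, this, Finset.sum_insert (by simp), add_comm]
  rfl

theorem start_len (τ : TreeType n) (l : τ.Cell) : τ.start l τ.len = n := by
  have h₁ : τ.start l τ.len = ∑ i, l.1 i := by
    rw [start, Finset.filter_true_of_mem (fun i _ => i.isLt)]
  have h₂ := Finset.sum_fiberwise (Finset.univ : Finset (Fin τ.len)) τ.lobe l.1
  rw [h₁, ← h₂]
  simp [l.2.2]

theorem travelled_zero (τ : TreeType n) (l : τ.Cell) (a : Fin n) : τ.travelled l 0 a = 0 := by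
  refine Finset.sum_eq_zero fun j _ => ?_
  have h : ∀ k, 0 ≤ τ.start l k := fun k => by
    rw [← τ.start_zero l]; exact τ.start_mono l (Nat.zero_le k)
  rw [min_eq_left (h _), min_eq_left (h _), sub_self]

theorem travelled_end (τ : TreeType n) (l : τ.Cell) (a : Fin n) : τ.travelled l n a = 1 := by
  rw [← l.2.2 a]
  refine Finset.sum_congr rfl fun j _ => ?_
  have h : ∀ k, k ≤ τ.len → τ.start l k ≤ n := fun k hk => by
    rw [← τ.start_len l]; exact τ.start_mono l hk
  rw [min_eq_right (h _ (by omega)), min_eq_right (h _ (by omega)), start_succ]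
  ring

theorem travelled_step (τ : TreeType n) (l : τ.Cell) {x y : ℝ} (hxy : x ≤ y) (j : ℕ) :
    min x (τ.start l (j + 1)) - min x (τ.start l j) ≤
      min y (τ.start l (j + 1)) - min y (τ.start l j) := by
  have h := τ.start_mono l (Nat.le_succ j)
  simp only [Nat.succ_eq_add_one] at h
  rcases le_total y (τ.start l j) with h₁ | h₁
  · rw [min_eq_left (h₁.trans h), min_eq_left h₁, min_eq_left ((hxy.trans h₁).trans h),
      min_eq_left (hxy.trans h₁)]
    simp
  · rw [min_eq_right h₁]
    rcases le_total x (τ.start l j) with h₂ | h₂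
    · rw [min_eq_left h₂, min_eq_left (h₂.trans h), sub_self]
      exact sub_nonneg.mpr (le_min h₁ h)
    · rw [min_eq_right h₂]
      exact sub_le_sub_right (min_le_min_right _ hxy) _

theorem travelled_mono (τ : TreeType n) (l : τ.Cell) {x y : ℝ} (hxy : x ≤ y) (a : Fin n) :
    τ.travelled l x a ≤ τ.travelled l y a :=
  Finset.sum_le_sum fun j _ => τ.travelled_step l hxy j

theorem travelled_sum (τ : TreeType n) (l : τ.Cell) {y : ℝ} (h₀ : 0 ≤ y) (h₁ : y ≤ n) :
    ∑ a, τ.travelled l y a = y := by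
  have h₂ := Finset.sum_fiberwise (Finset.univ : Finset (Fin τ.len)) τ.lobe
    (fun j => min y (τ.start l (j + 1)) - min y (τ.start l j))
  simp only [travelled]
  rw [h₂, Fin.sum_univ_eq_sum_range
    (fun j => min y (τ.start l (j + 1)) - min y (τ.start l j)) τ.len,
    Finset.sum_range_sub (fun j => min y (τ.start l j)), start_len, start_zero,
    min_eq_left h₁, min_eq_right h₀, sub_zero]

/-- An arc of the lobe `a` which is met between `x` and `y`. -/
theorem exists_arc (τ : TreeType n) (l : τ.Cell) {x y : ℝ} {a : Fin n}
    (h : τ.travelled l x a < τ.travelled l y a) :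
    ∃ j, τ.lobe j = a ∧ τ.start l j < y ∧ x < τ.start l (j + 1) := by
  obtain ⟨j, hj, hlt⟩ := Finset.exists_lt_of_sum_lt h
  refine ⟨j, by simpa using hj, ?_, ?_⟩
  · by_contra! hle
    have hs := τ.start_mono l (Nat.le_succ j)
    simp only [Nat.succ_eq_add_one] at hs
    rw [min_eq_left (hle.trans hs), min_eq_left hle, sub_self] at hlt
    exact absurd hlt (not_lt.mpr (sub_nonneg.mpr (min_le_min_left _ hs)))
  · by_contra! hle
    have hs := τ.start_mono l (Nat.le_succ j)
    simp only [Nat.succ_eq_add_one] at hs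
    rw [min_eq_right hle, min_eq_right (hs.trans hle)] at hlt
    have hxy : x ≤ y := by
      by_contra! hyx
      have := τ.travelled_mono l hyx.le a
      linarith
    rw [min_eq_right (hle.trans hxy), min_eq_right ((hs.trans hle).trans hxy)] at hlt
    exact lt_irrefl _ hlt

theorem travelled_treeLike (τ : TreeType n) (l : τ.Cell) {a b : Fin n} (hab : a ≠ b)
    (x₀ x₁ x₂ x₃ x₄ : ℝ) :
    ¬ (τ.travelled l x₀ a < τ.travelled l x₁ a ∧ τ.travelled l x₁ b < τ.travelled l x₂ b ∧
       τ.travelled l x₂ a < τ.travelled l x₃ a ∧ τ.travelled l x₃ b < τ.travelled l x₄ b) := by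
  rintro ⟨h₁, h₂, h₃, h₄⟩
  obtain ⟨j₁, e₁, l₁, -⟩ := τ.exists_arc l h₁
  obtain ⟨j₂, e₂, l₂, r₂⟩ := τ.exists_arc l h₂
  obtain ⟨j₃, e₃, l₃, r₃⟩ := τ.exists_arc l h₃
  obtain ⟨j₄, e₄, -, r₄⟩ := τ.exists_arc l h₄
  have key : ∀ j k : Fin τ.len, ∀ x : ℝ, τ.lobe j ≠ τ.lobe k → τ.start l j < x →
      x < τ.start l (k + 1) → j < k := by
    intro j k x hne hj hk
    by_contra! hle
    have hlt : k < j := lt_of_le_of_ne hle (fun e => hne (by rw [e]))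
    have hlt' : k.val + 1 ≤ j.val := hlt
    have := τ.start_mono l hlt'
    linarith
  have := τ.planar j₁ j₂ j₃ j₄ (key _ _ x₁ (by rw [e₁, e₂]; exact hab) l₁ r₂)
    (key _ _ x₂ (by rw [e₂, e₃]; exact hab.symm) l₂ r₃)
    (key _ _ x₃ (by rw [e₃, e₄]; exact hab) l₃ r₄) (e₁.trans e₃.symm) (e₂.trans e₄.symm)
  exact hab (by rw [← e₁, this, e₂])

/-- The perimeter of the normalized spineless cactus with arcs of lengths `l`; the outside circle
has length `n`. -/
noncomputable def perim (τ : TreeType n) (l : τ.Cell) (x : ℝ) (a : Fin n) : ℝ :=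
  ⌊x⌋ + τ.travelled l (n * Int.fract x) a

theorem perim_add_one (τ : TreeType n) (l : τ.Cell) (x : ℝ) (a : Fin n) :
    τ.perim l (x + 1) a = τ.perim l x a + 1 := by
  simp [perim]; ring

theorem perim_eq (τ : TreeType n) (l : τ.Cell) (k : ℤ) (x : ℝ) (h₀ : (k : ℝ) ≤ x)
    (h₁ : x ≤ k + 1) (a : Fin n) : τ.perim l x a = k + τ.travelled l (n * (x - k)) a := by
  rcases h₁.lt_or_eq with h₁ | rfl
  · have : ⌊x⌋ = k := Int.floor_eq_iff.mpr ⟨h₀, h₁⟩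
    simp [perim, Int.fract, this]
  · rw [perim_add_one]
    simp [perim, travelled_zero, travelled_end]

theorem perim_mono (τ : TreeType n) (l : τ.Cell) (a : Fin n) :
    Monotone fun x => τ.perim l x a := by
  have hn : (0 : ℝ) ≤ n := Nat.cast_nonneg n
  intro x y hxy
  have hfl := Int.floor_mono hxy
  rcases hfl.lt_or_eq with hlt | heq
  · have h₁ : τ.perim l x a ≤ ⌊x⌋ + 1 := by
      have := τ.travelled_mono l (mul_le_mul_of_nonneg_left (Int.fract_lt_one x).le hn) a
      rw [mul_one, travelled_end] at this
      simp only [perim]; linarith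
    have h₂ : (⌊y⌋ : ℝ) ≤ τ.perim l y a := by
      have := τ.travelled_mono l (mul_nonneg hn (Int.fract_nonneg y)) a
      rw [travelled_zero] at this
      simp only [perim]; linarith
    have h₃ : (⌊x⌋ : ℝ) + 1 ≤ ⌊y⌋ := by exact_mod_cast hlt
    exact (h₁.trans h₃).trans h₂
  · have : Int.fract x ≤ Int.fract y := by
      rw [Int.fract, Int.fract, heq]; linarith
    have := τ.travelled_mono l (mul_le_mul_of_nonneg_left this hn) a
    simp only [perim, heq]; linarith

theorem perim_linear_treeLike (τ : TreeType n) (l : τ.Cell) {a b : Fin n} (hab : a ≠ b) (k : ℤ)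
    (x₀ x₁ x₂ x₃ x₄ : ℝ) (hk : (k : ℝ) ≤ x₀) (hk' : x₄ ≤ k + 1) :
    ¬ (τ.perim l x₀ a < τ.perim l x₁ a ∧ τ.perim l x₁ b < τ.perim l x₂ b ∧
       τ.perim l x₂ a < τ.perim l x₃ a ∧ τ.perim l x₃ b < τ.perim l x₄ b) := by
  rintro ⟨h₁, h₂, h₃, h₄⟩
  have l₁ := (τ.perim_mono l a).reflect_lt h₁
  have l₂ := (τ.perim_mono l b).reflect_lt h₂
  have l₃ := (τ.perim_mono l a).reflect_lt h₃
  have l₄ := (τ.perim_mono l b).reflect_lt h₄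
  rw [τ.perim_eq l k x₀ (by linarith) (by linarith), τ.perim_eq l k x₁ (by linarith)
    (by linarith)] at h₁
  rw [τ.perim_eq l k x₁ (by linarith) (by linarith), τ.perim_eq l k x₂ (by linarith)
    (by linarith)] at h₂
  rw [τ.perim_eq l k x₂ (by linarith) (by linarith), τ.perim_eq l k x₃ (by linarith)
    (by linarith)] at h₃
  rw [τ.perim_eq l k x₃ (by linarith) (by linarith), τ.perim_eq l k x₄ (by linarith)
    (by linarith)] at h₄
  exact τ.travelled_treeLike l hab _ _ _ _ _ ⟨lt_of_add_lt_add_left h₁,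
    lt_of_add_lt_add_left h₂, lt_of_add_lt_add_left h₃, lt_of_add_lt_add_left h₄⟩

theorem perim_treeLike (τ : TreeType n) (l : τ.Cell) {a b : Fin n} (hab : a ≠ b)
    (x₀ x₁ x₂ x₃ x₄ : ℝ) (hx : x₄ ≤ x₀ + 1) :
    ¬ (τ.perim l x₀ a < τ.perim l x₁ a ∧ τ.perim l x₁ b < τ.perim l x₂ b ∧
       τ.perim l x₂ a < τ.perim l x₃ a ∧ τ.perim l x₃ b < τ.perim l x₄ b) := by
  rintro ⟨h₁, h₂, h₃, h₄⟩
  have l₁ := (τ.perim_mono l a).reflect_lt h₁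
  have l₂ := (τ.perim_mono l b).reflect_lt h₂
  have l₃ := (τ.perim_mono l a).reflect_lt h₃
  have l₄ := (τ.perim_mono l b).reflect_lt h₄
  have lin := fun (c d : Fin n) (hcd : c ≠ d) => τ.perim_linear_treeLike l hcd (⌊x₀⌋ + 1)
  push_cast at lin
  have f₀ := Int.floor_le x₀
  have f₁ := Int.lt_floor_add_one x₀
  set K : ℝ := (⌊x₀⌋ : ℝ) + 1 with hK
  have s := τ.perim_add_one l
  have m : ∀ c x y, x ≤ y → τ.perim l x c ≤ τ.perim l y c := fun c x y h => τ.perim_mono l c h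
  have w : τ.perim l x₄ a ≤ τ.perim l (x₀ + 1) a := m a _ _ hx
  have s₀ := s x₀ a
  have s₁ := s x₁ a
  have s₁' := s x₁ b
  have s₂ := s x₂ b
  have s₂' := s x₂ a
  have s₃ := s x₃ a
  have s₃' := s x₃ b
  have sK := s K a
  have sK' := s K b
  by_cases c₄ : x₄ ≤ K
  · exact τ.perim_linear_treeLike l hab ⌊x₀⌋ _ _ _ _ _ f₀ c₄ ⟨h₁, h₂, h₃, h₄⟩
  by_cases c₃ : x₃ ≤ K
  · rcases lt_or_ge (τ.perim l K b) (τ.perim l x₄ b) with h | h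
    · exact lin b a hab.symm K x₄ (x₁ + 1) (x₂ + 1) (x₃ + 1) le_rfl (by linarith)
        ⟨h, by linarith, by linarith, by linarith⟩
    · exact lin a b hab x₄ (x₁ + 1) (x₂ + 1) (x₃ + 1) (K + 1) (by linarith) le_rfl
        ⟨by linarith, by linarith, by linarith, by linarith⟩
  by_cases c₂ : x₂ ≤ K
  · rcases lt_or_ge (τ.perim l K a) (τ.perim l x₃ a) with h | h
    · exact lin a b hab K x₃ x₄ (x₁ + 1) (x₂ + 1) le_rfl (by linarith)
        ⟨h, by linarith, by linarith, by linarith⟩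
    · exact lin b a hab.symm x₃ x₄ (x₁ + 1) (x₂ + 1) (K + 1) (by linarith) le_rfl
        ⟨by linarith, by linarith, by linarith, by linarith⟩
  by_cases c₁ : x₁ ≤ K
  · rcases lt_or_ge (τ.perim l K b) (τ.perim l x₂ b) with h | h
    · exact lin b a hab.symm K x₂ x₃ x₄ (x₁ + 1) le_rfl (by linarith)
        ⟨h, by linarith, by linarith, by linarith⟩
    · exact lin a b hab x₂ x₃ x₄ (x₁ + 1) (K + 1) (by linarith) le_rfl
        ⟨by linarith, by linarith, by linarith, by linarith⟩
  · rcases lt_or_ge (τ.perim l K a) (τ.perim l x₁ a) with h | h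
    · exact lin a b hab K x₁ x₂ x₃ x₄ le_rfl (by linarith)
        ⟨h, by linarith, by linarith, by linarith⟩
    · exact lin b a hab.symm x₁ x₂ x₃ x₄ (K + 1) (by linarith) le_rfl
        ⟨by linarith, by linarith, by linarith, by linarith⟩

theorem perim_finite_arcs (τ : TreeType n) (l : τ.Cell) (u v : ℝ) :
    ∃ B : Finset ℝ, ∀ x y : ℝ, u ≤ x → x ≤ y → y ≤ v →
      (∀ b ∈ B, ¬ (x < b ∧ b < y)) → ∃ a, ∀ b, b ≠ a → τ.perim l x b = τ.perim l y b := by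
  classical
  have hn : (0 : ℝ) < n := Nat.cast_pos.mpr τ.pos
  refine ⟨((Finset.Icc ⌊u⌋ ⌈v⌉) ×ˢ Finset.range (τ.len + 1)).image
    (fun q => (q.1 : ℝ) + τ.start l q.2 / n), fun x y hux hxy hyv hB => ?_⟩
  rcases hxy.eq_or_lt with rfl | hxy
  · exact ⟨⟨0, τ.pos⟩, fun _ _ => rfl⟩
  have hB' : ∀ k : ℤ, ∀ j : ℕ, j ≤ τ.len → ⌊u⌋ ≤ k → k ≤ ⌈v⌉ →
      ¬ (x < k + τ.start l j / n ∧ k + τ.start l j / n < y) := by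
    intro k j hj h₁ h₂
    refine hB _ (Finset.mem_image.mpr ⟨(k, j), ?_, rfl⟩)
    simp only [Finset.mem_product, Finset.mem_Icc, Finset.mem_range]
    exact ⟨⟨h₁, h₂⟩, by omega⟩
  set k := ⌊x⌋ with hk
  have hk₀ : (k : ℝ) ≤ x := Int.floor_le x
  have hk₁ : x < k + 1 := Int.lt_floor_add_one x
  have huk : ⌊u⌋ ≤ k := Int.floor_mono hux
  have hkv : k ≤ ⌈v⌉ := by
    have : (k : ℝ) ≤ ⌈v⌉ := by linarith [Int.le_ceil v]
    exact_mod_cast this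
  have hy : y ≤ k + 1 := by
    by_contra! hlt
    have h := hB' k τ.len le_rfl huk hkv
    rw [start_len, div_self hn.ne'] at h
    exact h ⟨hk₁, hlt⟩
  have hX : τ.start l (Nat.findGreatest (fun j => τ.start l j ≤ n * (x - k)) τ.len) ≤
      n * (x - k) :=
    Nat.findGreatest_spec (P := fun j => τ.start l j ≤ n * (x - k)) (Nat.zero_le _)
      (by rw [start_zero]; exact mul_nonneg hn.le (by linarith))
  have hle := Nat.findGreatest_le (P := fun j => τ.start l j ≤ n * (x - k)) τ.len
  have hgt : ∀ j, Nat.findGreatest (fun j => τ.start l j ≤ n * (x - k)) τ.len < j → j ≤ τ.len →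
      ¬ τ.start l j ≤ n * (x - k) := fun j h₁ h₂ => Nat.findGreatest_is_greatest h₁ h₂
  set j := Nat.findGreatest (fun j => τ.start l j ≤ n * (x - k)) τ.len
  have hj : j < τ.len := by
    refine lt_of_le_of_ne hle fun e => ?_
    rw [e, start_len] at hX
    nlinarith
  have hY : n * (y - k) ≤ τ.start l (j + 1) := by
    by_contra! hlt
    refine hB' k (j + 1) hj huk hkv ⟨?_, ?_⟩
    · have := hgt (j + 1) (Nat.lt_succ_self j) hj
      rw [not_le, ← lt_div_iff₀' hn] at this
      linarith
    · rw [← div_lt_iff₀' hn] at hlt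
      linarith
  refine ⟨τ.lobe ⟨j, hj⟩, fun b hb => ?_⟩
  rw [τ.perim_eq l k x hk₀ hk₁.le, τ.perim_eq l k y (by linarith) hy]
  congr 1
  refine Finset.sum_congr rfl fun i hi => ?_
  have hxy' : n * (x - k) ≤ n * (y - k) := mul_le_mul_of_nonneg_left (by linarith) hn.le
  have hij : (i : ℕ) ≠ j := by
    intro e
    simp only [Finset.mem_filter, Finset.mem_univ, true_and] at hi
    exact hb (by rw [← hi]; congr 1; exact Fin.ext e)
  rcases lt_or_gt_of_ne hij with h | h
  · have h₁ : τ.start l (i + 1) ≤ n * (x - k) := (τ.start_mono l h).trans hX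
    have h₂ : τ.start l i ≤ n * (x - k) := (τ.start_mono l h.le).trans hX
    rw [min_eq_right h₁, min_eq_right h₂, min_eq_right (h₁.trans hxy'),
      min_eq_right (h₂.trans hxy')]
  · have h₁ : n * (y - k) ≤ τ.start l i := hY.trans (τ.start_mono l h)
    have h₂ : n * (y - k) ≤ τ.start l (i + 1) := h₁.trans (τ.start_mono l (Nat.le_succ _))
    rw [min_eq_left h₁, min_eq_left h₂, min_eq_left (hxy'.trans h₁), min_eq_left (hxy'.trans h₂),
      sub_self, sub_self]

/-- The characteristic map of the closed cell of `τ`: the normalized spineless cactus whose arcs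
have the lengths `l`; arcs of length zero are contracted. -/
noncomputable def cellMap (τ : TreeType n) (l : τ.Cell) : NormalizedSpinelessCactus n :=
  ⟨{ radius := fun _ => 1
     perim := τ.perim l
     pos := τ.pos
     radius_pos := fun _ => one_pos
     perim_zero := fun a => by simp [perim, travelled_zero]
     perim_add_one := τ.perim_add_one l
     mono := τ.perim_mono l
     arclength := fun x => by
      have hn : (0 : ℝ) ≤ n := Nat.cast_nonneg n
      have h := τ.travelled_sum l (mul_nonneg hn (Int.fract_nonneg x))
        (mul_le_of_le_one_right hn (Int.fract_lt_one x).le)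
      simp only [one_mul, perim, Finset.sum_add_distrib, h]
      simp only [Finset.sum_const, Finset.card_univ, Fintype.card_fin, nsmul_eq_mul, mul_one]
      rw [← mul_add, Int.floor_add_fract]
     finite_arcs := τ.perim_finite_arcs l
     treeLike := fun _ _ hab => τ.perim_treeLike l hab }, fun _ => rfl⟩

end TreeType

/-- The topology of the space of normalized spineless cacti: that of the cell complex with one
closed cell for each tree, that is, the quotient topology of the disjoint union of the closed
cells. -/
noncomputable instance (n : ℕ) : TopologicalSpace (NormalizedSpinelessCactus n) :=
  ⨆ τ : TreeType n, TopologicalSpace.coinduced τ.cellMap inferInstance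

/-- All lobes are rescaled to radius one. -/
noncomputable def SpinelessCactus.normalize {n : ℕ} (c : SpinelessCactus n) :
    NormalizedSpinelessCactus n :=
  ⟨c.rescale (fun _ => 1) (fun _ => one_pos), fun _ => rfl⟩

/-- The topology of the space of spineless cacti: that of the product of the space of normalized
spineless cacti with the space of radii. -/
noncomputable instance (n : ℕ) : TopologicalSpace (SpinelessCactus n) :=
  TopologicalSpace.induced
    (fun c => ((c.normalize, c.radius) : NormalizedSpinelessCactus n × (Fin n → ℝ))) inferInstance

theorem SpinelessCactus.radius_rotate {n : ℕ} (θ : UnitAddCircle) (c : SpinelessCactus n) :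
    (c.rotate θ).radius = c.radius := by
  induction θ using QuotientAddGroup.induction_on with
  | H t => rfl

/-- Radii one, except for radius `n` of the `i`-th lobe. -/
def stretch {m : ℕ} (i : Fin m) (n : ℕ) : Fin m → ℝ := Function.update (fun _ => 1) i (n : ℝ)

theorem stretch_pos {m n : ℕ} (i : Fin m) (hn : 0 < n) (a : Fin m) : 0 < stretch i n a := by
  by_cases h : a = i
  · subst h; simpa [stretch] using hn
  · simp [stretch, h]

theorem splice_stretch {m n p : ℕ} (h : m + n = p + 1) (i : Fin m) (hn : 0 < n) (r : Fin n → ℝ)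
    (hr : ∀ k, r k = 1) (q : Fin p) :
    splice h i (stretch i n) (fun k => stretch i n i / (∑ l, r l) * r k) q = 1 := by
  have hn' : (n : ℝ) ≠ 0 := by exact_mod_cast hn.ne'
  revert q
  refine forall_slot h i (fun j => ?_) (fun k => ?_)
  · simp [stretch, j.2]
  · simp [stretch, hr, hn']

namespace NormalizedSpinelessCactus

/-- Gluing of normalized spineless cacti: the `i`-th lobe of `c` is re-parametrized to length `n`,
and then identified with the outside circle of `c'`, which has length `n`. -/
noncomputable def glue {m n p : ℕ} (h : m + n = p + 1) (i : Fin m)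
    (c : NormalizedSpinelessCactus m) (c' : NormalizedSpinelessCactus n) :
    NormalizedSpinelessCactus p :=
  ⟨(c.1.rescale (stretch i n) (stretch_pos i c'.1.pos)).glue h i c'.1,
    splice_stretch h i c'.1.pos _ c'.2⟩

/-- Rotation of the base point clockwise around the perimeter. -/
def rotate {n : ℕ} (θ : UnitAddCircle) (c : NormalizedSpinelessCactus n) :
    NormalizedSpinelessCactus n :=
  ⟨c.1.rotate θ, fun a => by rw [c.1.radius_rotate]; exact c.2 a⟩

instance (n : ℕ) : MulAction (Equiv.Perm (Fin n)) (NormalizedSpinelessCactus n) where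
  smul σ c := ⟨σ • c.1, fun a => c.2 (σ⁻¹ a)⟩
  one_smul _ := rfl
  mul_smul _ _ _ := rfl

end NormalizedSpinelessCactus

/-! ## Cacti (with spines) -/

/-- A cactus (with spines): the local zeros of the lobes are arbitrary points of the lobes.  It is
recorded by the radii of the lobes and by the perimeter as a map from the outside circle, starting
at the global zero, to the product of the lobes, where now the angles on each lobe are measured from
its local zero.  Forgetting the local zeros gives a spineless cactus `C`, and `z a` is the
coordinate of the local zero of the lobe `a`, measured counterclockwise from the intersection point
with the lobe below it (or from the global zero). -/
@[ext] structure Cactus (n : ℕ) where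
  /-- radii (lengths) of the lobes -/
  radius : Fin n → ℝ
  /-- the perimeter, in the angles measured from the local zeros -/
  perim : UnitAddCircle → Fin n → UnitAddCircle
  exists_zeros : ∃ (C : SpinelessCactus n) (z : Fin n → UnitAddCircle),
    C.radius = radius ∧ ∀ x a, perim x a = C.outer x a - z a

namespace Cactus

variable {n : ℕ}

/-- The cactus obtained from a spineless cactus by choosing local zeros with the coordinates
`z`. -/
def ofSpineless (C : SpinelessCactus n) (z : Fin n → UnitAddCircle) : Cactus n where
  radius := C.radius
  perim x a := C.outer x a - z a
  exists_zeros := ⟨C, z, rfl, fun _ _ => rfl⟩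

/-- The topology of the space of cacti: that of the product of the space of spineless cacti with
the space of local zeros. -/
noncomputable instance : TopologicalSpace (Cactus n) :=
  TopologicalSpace.coinduced
    (fun q : SpinelessCactus n × (Fin n → UnitAddCircle) => ofSpineless q.1 q.2) inferInstance

/-- Gluing: the outside circle of `c'` is re-parametrized to the length of the `i`-th lobe of `c`
and identified with this lobe, the global zero of `c'` with the local zero of the lobe; all lobes of
`c'` are rescaled accordingly. -/
noncomputable def glue {m n p : ℕ} (h : m + n = p + 1) (i : Fin m) (c : Cactus m)
    (c' : Cactus n) : Cactus p where
  radius := splice h i c.radius (fun k => c.radius i / (∑ l, c'.radius l) * c'.radius k)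
  perim x := splice h i (c.perim x) (c'.perim (c.perim x i))
  exists_zeros := by
    obtain ⟨C, z, hr, hz⟩ := c.exists_zeros
    obtain ⟨C', z', hr', hz'⟩ := c'.exists_zeros
    refine ⟨C.glue h i (C'.rotate (z i)), splice h i z (fun k => C'.diagonal (z i) k + z' k),
      ?_, fun x => ?_⟩
    · simp only [SpinelessCactus.glue, SpinelessCactus.radius_rotate, hr, hr']
    · obtain ⟨t, rfl⟩ := QuotientAddGroup.mk_surjective x
      obtain ⟨s, hs⟩ := QuotientAddGroup.mk_surjective (z i)
      refine forall_slot h i (fun j => ?_) (fun k => ?_)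
      · simp only [splice_inl, hz]
        congr 1
        change ((C.perim t j : ℝ) : UnitAddCircle) = (((C.glue h i _).perim t _ : ℝ) : UnitAddCircle)
        simp [SpinelessCactus.glue]
      · simp only [splice_inr, hz', hz, ← hs]
        change (((C'.perim (C.perim t i - s) k : ℝ)) : UnitAddCircle) - z' k =
          (((C.glue h i (C'.rotateBy s)).perim t _ : ℝ) : UnitAddCircle) -
            (-((C'.perim (-s) k : ℝ) : UnitAddCircle) + z' k)
        simp only [SpinelessCactus.glue, splice_inr, SpinelessCactus.rotateBy, AddCircle.coe_sub]
        abel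

/-- The cactus with the same underlying configuration, the lobes being rescaled to the radii
`s`. -/
noncomputable def rescale (c : Cactus n) (s : Fin n → ℝ) (hs : ∀ a, 0 < s a) : Cactus n :=
  ofSpineless (c.exists_zeros.choose.rescale s hs) c.exists_zeros.choose_spec.choose

/-- Renaming the lobes. -/
instance : MulAction (Equiv.Perm (Fin n)) (Cactus n) where
  smul σ c :=
    { radius := fun b => c.radius (σ⁻¹ b)
      perim := fun x b => c.perim x (σ⁻¹ b)
      exists_zeros := by
        obtain ⟨C, z, hr, hz⟩ := c.exists_zeros
        refine ⟨σ • C, fun b => z (σ⁻¹ b), by rw [← hr]; rfl, fun x b => ?_⟩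
        rw [hz]
        obtain ⟨t, rfl⟩ := QuotientAddGroup.mk_surjective x
        rfl }
  one_smul _ := rfl
  mul_smul _ _ _ := rfl

end Cactus

/-- Normalized cacti: the subspace of cacti all lobes of which have radius one. -/
def NormalizedCactus (n : ℕ) : Type := {c : Cactus n // ∀ a, c.radius a = 1}

namespace NormalizedCactus

noncomputable instance (n : ℕ) : TopologicalSpace (NormalizedCactus n) := instTopologicalSpaceSubtype

/-- The normalized cactus obtained from a normalized spineless cactus by choosing local zeros with
the coordinates `z`. -/
def ofSpineless {n : ℕ} (C : NormalizedSpinelessCactus n) (z : Fin n → UnitAddCircle) :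
    NormalizedCactus n :=
  ⟨Cactus.ofSpineless C.1 z, C.2⟩

theorem pos {n : ℕ} (c : NormalizedCactus n) : 0 < n := c.1.exists_zeros.choose.pos

/-- Gluing of normalized cacti: the `i`-th lobe of `c` is re-parametrized to length `n`, and then
identified with the outside circle of `c'`, local zero with global zero. -/
noncomputable def glue {m n p : ℕ} (h : m + n = p + 1) (i : Fin m)
    (c : NormalizedCactus m) (c' : NormalizedCactus n) : NormalizedCactus p :=
  ⟨(c.1.rescale (stretch i n) (stretch_pos i c'.pos)).glue h i c'.1,
    splice_stretch h i c'.pos _ c'.2⟩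

instance (n : ℕ) : MulAction (Equiv.Perm (Fin n)) (NormalizedCactus n) where
  smul σ c := ⟨σ • c.1, fun a => c.2 (σ⁻¹ a)⟩
  one_smul _ := rfl
  mul_smul _ _ _ := rfl

end NormalizedCactus

/-! ## The collections and compositions of the various kinds of cacti -/

/-- The spaces of cacti without spines. -/
noncomputable def Cact : SymCollection where
  obj := SpinelessCactus
  top _ := inferInstance
  act _ := inferInstance

/-- The compositions of cacti without spines. -/
noncomputable def cactComp : Compositions Cact := fun _ _ _ h i c c' =>
  SpinelessCactus.glue h i c c'

/-- The spaces of normalized cacti without spines. -/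
noncomputable def NCact : SymCollection where
  obj := NormalizedSpinelessCactus
  top _ := inferInstance
  act _ := inferInstance

/-- The compositions of normalized cacti without spines. -/
noncomputable def ncactComp : Compositions NCact := fun _ _ _ h i c c' =>
  NormalizedSpinelessCactus.glue h i c c'

/-- The spaces of cacti. -/
noncomputable def Cacti : SymCollection where
  obj := Cactus
  top _ := inferInstance
  act _ := inferInstance

/-- The compositions of cacti. -/
noncomputable def cactiComp : Compositions Cacti := fun _ _ _ h i c c' => Cactus.glue h i c c'

/-- The spaces of normalized cacti. -/
noncomputable def NCacti : SymCollection where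
  obj := NormalizedCactus
  top _ := inferInstance
  act _ := inferInstance

/-- The compositions of normalized cacti. -/
noncomputable def ncactiComp : Compositions NCacti := fun _ _ _ h i c c' =>
  NormalizedCactus.glue h i c c'

/-- The spaces `(S^1)^n`; the circle group is `ℝ / ℤ`, written additively. -/
def Circles : SymCollection := monoidCollection UnitAddCircle

/-- The compositions of the operad built on the monoid `S^1`. -/
def circlesComp : Compositions Circles := monoidComp UnitAddCircle

/-- Twisted gluing of spineless cacti: `C ∘_i^θ C' = C ∘_i ρ(θ_i, C')`, with `ρ` the rotation of the
base point. -/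
noncomputable def cactTwist : LeftTwist Cact Circles := fun _ _ _ h i C θ C' =>
  SpinelessCactus.glue h i C (SpinelessCactus.rotate (θ i) C')

/-- Twisted gluing of normalized spineless cacti. -/
noncomputable def ncactTwist : LeftTwist NCact Circles := fun _ _ _ h i C θ C' =>
  NormalizedSpinelessCactus.glue h i C (NormalizedSpinelessCactus.rotate (θ i) C')

/-- The perturbation of the operad built on `S^1` by the diagonal of a spineless cactus: the `i`-th
entry of `θ` is replaced by the product in `(S^1)^n` of `Δ_{C'}(θ_i)` and `θ'`. -/
def circlesTwist : RightTwist Cact Circles := fun _ _ _ h i θ C' θ' =>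
  splice h i θ (fun k => SpinelessCactus.diagonal C' (θ i) k + θ' k)

/-- The same perturbation by a normalized spineless cactus. -/
def ncirclesTwist : RightTwist NCact Circles := fun _ _ _ h i θ C' θ' =>
  splice h i θ (fun k => SpinelessCactus.diagonal C'.1 (θ i) k + θ' k)

end CactusOperad

open CactusOperad

namespace CactusOperad

open Filter Topology

/-! ### Splicing -/

/-! The algebra becomes transparent once a cactus is identified with its perimeter: gluing
substitutes one perimeter into a coordinate of another. Associativity and equivariance then reduce
to index identities for `splice` and to the fact that an inserted cactus is rescaled to the total
length of the lobe it replaces. Normalized gluing rescales first, which costs associativity but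
nothing else. Rescaling only reparametrizes the perimeter, and a perimeter's path together with its
radii determines the cactus (`SamePath.eq`), because arc length recovers the parameter; this yields
every identity about rescaling.

The topological input is that the cell complex of normalized spineless cacti carries the topology of
pointwise convergence of perimeters (`isClosedEmbedding_perim`). There are finitely many trees,
their compact closed cells cover the space, and a continuous injection of a compact space into a
Hausdorff space is a closed embedding. With radii adjoined, the same description holds for all
spineless cacti. Perimeters are monotone and continuous in the outside angle, so pointwise
continuity in parameters upgrades to joint continuity (`continuous_uncurry_of_monotone`). Gluing,
rotating and rescaling are continuous for this reason.

For a cactus with spines, the coordinates of the local zeros are minus the value of the perimeter at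
the global zero, and the spineless perimeter is the unique lift of what remains. When local zeros
are present, the inner perimeter is entered at the angle `-z i`. Renormalizing it to start at zero
rotates the inner cactus by `z i`, and the constant removed in doing so is absorbed by the diagonal
`Δ`. This is precisely the bi-crossed composition (`Cactus.ofSpineless_glue`).

The bi-crossed product deforms to the semi-direct one because each coordinate of `Δ` lifts to a map
of degree one, which can be moved linearly to the identity. No associativity is required along the
way, so every stage is a quasi-operad.

For the last claim, normalization does not respect the compositions of all cacti, since the outside
parametrization of the inner cactus depends on its radii. So the compositions are deformed: the
inner radii are moved to `1` before gluing, the resulting radii being restored afterwards, while the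
plain diagonal is moved to the `Δ` of the shrunk cactus. At the end of the deformation normalization
is a morphism (`normalize_shrinkGlue_one`), and it is an equivariant homotopy equivalence because
radii can be contracted to `1`. -/

theorem splice_apply {X : Type*} {m n p : ℕ} (h : m + n = p + 1) (i : Fin m) (u : Fin m → X)
    (v : Fin n → X) (q : Fin p) :
    splice h i u v q = if h₁ : q.1 < i then u ⟨q.1, by omega⟩
      else if h₂ : q.1 < i + n then v ⟨q.1 - i, by omega⟩
      else u ⟨q.1 + 1 - n, by omega⟩ := by
  simp only [splice, slotEquiv, Equiv.coe_fn_symm_mk]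
  split_ifs <;> rfl

theorem splice_apply_of_lt {X : Type*} {m n p : ℕ} (h : m + n = p + 1) (i j : Fin m)
    (u : Fin m → X) (v : Fin n → X) (q : Fin p) (hj : j < i) (hq : (q : ℕ) = j) :
    splice h i u v q = u j := by
  have : q.1 < i.1 := by have : j.1 < i.1 := hj; omega
  rw [splice_apply, dif_pos this]
  congr 1
  exact Fin.ext hq

theorem splice_apply_of_gt {X : Type*} {m n p : ℕ} (h : m + n = p + 1) (i j : Fin m)
    (u : Fin m → X) (v : Fin n → X) (q : Fin p) (hj : i < j) (hq : (q : ℕ) + 1 = j + n) :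
    splice h i u v q = u j := by
  have : i.1 < j.1 := hj
  rw [splice_apply, dif_neg (by omega), dif_neg (by omega)]
  congr 1
  exact Fin.ext (by simp; omega)

theorem splice_apply_of_eq {X : Type*} {m n p : ℕ} (h : m + n = p + 1) (i : Fin m) (j : Fin n)
    (u : Fin m → X) (v : Fin n → X) (q : Fin p) (hq : (q : ℕ) = i + j) :
    splice h i u v q = v j := by
  rw [splice_apply, dif_neg (by omega), dif_pos (by omega)]
  congr 1
  exact Fin.ext (by simp; omega)

theorem map_splice {X Y : Type*} {m n p : ℕ} (f : X → Y) (h : m + n = p + 1) (i : Fin m)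
    (u : Fin m → X) (v : Fin n → X) (q : Fin p) :
    f (splice h i u v q) = splice h i (fun j => f (u j)) (fun k => f (v k)) q := by
  simp only [splice_apply]
  split_ifs <;> rfl

/-- The index part of nested associativity. Radii, perimeters and circle coordinates are all
composed by splicing, so this and the parallel version serve every operad below. -/
theorem splice_nested {X : Type*} {k l m p q r : ℕ} (h₁ : k + l = p + 1) (h₂ : p + m = r + 1)
    (h₃ : l + m = q + 1) (h₄ : k + q = r + 1) (i : Fin k) (j : Fin l) (j' : Fin p)
    (hj : (j' : ℕ) = i + j) (u : Fin k → X) (v : Fin l → X) (w : Fin m → X) :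
    splice h₂ j' (splice h₁ i u v) w = splice h₄ i u (splice h₃ j v w) := by
  funext s
  simp only [splice_apply]
  split_ifs <;> first | rfl | (exfalso; omega) | (congr 1; ext; simp; omega)

theorem splice_parallel {X : Type*} {k l m p q r : ℕ} (h₁ : k + l = p + 1) (h₂ : p + m = r + 1)
    (h₃ : k + m = q + 1) (h₄ : q + l = r + 1) (i j : Fin k) (j' : Fin p) (i' : Fin q)
    (hji : j < i) (hj : (j' : ℕ) = j) (hi : (i' : ℕ) + 1 = i + m)
    (u : Fin k → X) (v : Fin l → X) (w : Fin m → X) :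
    splice h₂ j' (splice h₁ i u v) w = splice h₄ i' (splice h₃ j u w) v := by
  have : j.1 < i.1 := hji
  funext s
  simp only [splice_apply]
  split_ifs <;> first | rfl | (exfalso; omega) | (congr 1; ext; simp; omega)

/-- The index part of equivariance. Writing the slot as an image under `blockPerm` leaves two cases,
an old slot and a slot of the inserted block, in which both sides are evaluated directly. -/
theorem splice_perm {X : Type*} {m n p : ℕ} (h : m + n = p + 1) (i : Fin m)
    (σ : Equiv.Perm (Fin m)) (τ : Equiv.Perm (Fin n)) (u : Fin m → X) (v : Fin n → X) :
    splice h (σ i) (fun j => u (σ⁻¹ j)) (fun k => v (τ⁻¹ k)) =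
      fun q => splice h i u v ((blockPerm h i σ τ)⁻¹ q) := by
  funext q
  obtain ⟨q, rfl⟩ := (blockPerm h i σ τ).surjective q
  rw [← Equiv.Perm.mul_apply, inv_mul_cancel, Equiv.Perm.one_apply]
  revert q
  refine forall_slot h i (fun j => ?_) (fun k => ?_)
  · rw [splice_inl]
    simp only [blockPerm, Equiv.trans_apply, Equiv.symm_apply_apply, Equiv.sumCongr_apply,
      Sum.map_inl, splice_inl]
    simp
  · rw [splice_inr]
    simp [blockPerm]

theorem continuous_splice {X Y : Type*} [TopologicalSpace X] [TopologicalSpace Y] {m n p : ℕ}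
    (h : m + n = p + 1) (i : Fin m) {u : Y → Fin m → X} {v : Y → Fin n → X} (hu : Continuous u)
    (hv : Continuous v) : Continuous fun y => splice h i (u y) (v y) := by
  refine continuous_pi (forall_slot h i (fun j => ?_) (fun k => ?_))
  · simp only [splice_inl]; fun_prop
  · simp only [splice_inr]; fun_prop

/-- The compositions of the operad built on a monoid are associative, continuous and equivariant. -/
theorem isOperad_monoid (S : Type) [TopologicalSpace S] [AddMonoid S] [ContinuousAdd S] :
    IsOperad (monoidCollection S) (monoidComp S) where
  continuous_act n σ := by
    refine continuous_pi fun b => ?_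
    exact continuous_apply (A := fun _ : Fin n => S) (σ⁻¹ b)
  continuous_comp m n p h i := by
    change Continuous fun q : (Fin m → S) × (Fin n → S) =>
      CactusOperad.splice h i q.1 (fun k => q.1 i + q.2 k)
    exact continuous_splice h i continuous_fst (by fun_prop)
  equivariant m n p h i σ τ a b := by
    -- On tuples the action is precomposition with the inverse permutation; the factor multiplying
    -- the block is the entry of `σ • a` at `σ i`, that is `a i`.
    have key : ∀ (a : Fin m → S) (b : Fin n → S),
        splice h (σ i) (fun j => a (σ⁻¹ j)) (fun k => a (σ⁻¹ (σ i)) + b (τ⁻¹ k)) =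
          fun q => splice h i a (fun k => a i + b k) ((blockPerm h i σ τ)⁻¹ q) := by
      intro a b
      rw [← Equiv.Perm.mul_apply, inv_mul_cancel, Equiv.Perm.one_apply]
      exact splice_perm h i σ τ a (fun k => a i + b k)
    exact key a b
  assoc_nested k l m p q r h₁ h₂ h₃ h₄ i j j' hj a b c := by
    have key : ∀ (a : Fin k → S) (b : Fin l → S) (c : Fin m → S),
        splice h₂ j' (splice h₁ i a fun k => a i + b k)
          (fun k => splice h₁ i a (fun k => a i + b k) j' + c k) =
        splice h₄ i a (fun k => a i + splice h₃ j b (fun k => b j + c k) k) := by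
      intro a b c
      rw [splice_apply_of_eq h₁ i j _ _ j' hj, splice_nested h₁ h₂ h₃ h₄ i j j' hj]
      congr 1
      funext s
      rw [map_splice (fun x => a i + x)]
      simp only [add_assoc]
    exact key a b c
  assoc_parallel k l m p q r h₁ h₂ h₃ h₄ i j j' i' hji hj hi a b c := by
    have key : ∀ (a : Fin k → S) (b : Fin l → S) (c : Fin m → S),
        splice h₂ j' (splice h₁ i a fun k => a i + b k)
          (fun k => splice h₁ i a (fun k => a i + b k) j' + c k) =
        splice h₄ i' (splice h₃ j a fun k => a j + c k)
          (fun k => splice h₃ j a (fun k => a j + c k) i' + b k) := by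
      intro a b c
      rw [splice_apply_of_lt h₁ i j _ _ j' hji hj, splice_apply_of_gt h₃ j i _ _ i' hji hi,
        splice_parallel h₁ h₂ h₃ h₄ i j j' i' hji hj hi]
    exact key a b c

/-! ### Families of monotone functions -/

/-- A lower bound at `(q, x)` already holds at some `y < x` by continuity in the real variable; it
persists at `y` for nearby parameters, and monotonicity carries it to all points beyond `y`. Upper
bounds are symmetric. -/
theorem continuous_uncurry_of_monotone {Q : Type*} [TopologicalSpace Q] {f : Q → ℝ → ℝ}
    (hm : ∀ q, Monotone (f q)) (hx : ∀ q, Continuous (f q))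
    (hq : ∀ x, Continuous fun q => f q x) : Continuous fun z : Q × ℝ => f z.1 z.2 := by
  rw [continuous_iff_continuousAt]
  rintro ⟨q, x⟩
  refine tendsto_order.2 ⟨fun a ha => ?_, fun a ha => ?_⟩
  · have h₁ : ∀ᶠ y in 𝓝[<] x, a < f q y :=
      ((hx q).continuousAt.tendsto.mono_left nhdsWithin_le_nhds).eventually_const_lt ha
    obtain ⟨y, hy, hyx⟩ := (h₁.and self_mem_nhdsWithin).exists
    have h₂ : ∀ᶠ q' in 𝓝 q, a < f q' y := (hq y).continuousAt.eventually_const_lt hy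
    filter_upwards [h₂.prod_nhds (lt_mem_nhds (show y < x from hyx))] with z hz
    exact hz.1.trans_le (hm _ hz.2.le)
  · have h₁ : ∀ᶠ y in 𝓝[>] x, f q y < a :=
      ((hx q).continuousAt.tendsto.mono_left nhdsWithin_le_nhds).eventually_lt_const ha
    obtain ⟨y, hy, hyx⟩ := (h₁.and self_mem_nhdsWithin).exists
    have h₂ : ∀ᶠ q' in 𝓝 q, f q' y < a := (hq y).continuousAt.eventually_lt_const hy
    filter_upwards [h₂.prod_nhds (gt_mem_nhds (show x < y from hyx))] with z hz
    exact (hm _ hz.2.le).trans_lt hz.1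

/-- By strict monotonicity `a < g q` is the same as `f q a < x q`, an open condition on `q`;
likewise for the other inequality. -/
theorem continuous_solution_of_strictMono {Q : Type*} [TopologicalSpace Q] {f : Q → ℝ → ℝ}
    (hm : ∀ q, StrictMono (f q)) (hq : ∀ x, Continuous fun q => f q x) {g x : Q → ℝ}
    (hx : Continuous x) (hg : ∀ q, f q (g q) = x q) : Continuous g := by
  rw [continuous_iff_continuousAt]
  intro q
  refine tendsto_order.2 ⟨fun a ha => ?_, fun a ha => ?_⟩
  · have : f q a < x q := by rw [← hg]; exact hm q ha
    filter_upwards [(hq a).continuousAt.eventually_lt hx.continuousAt this] with q' h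
    rw [← hg] at h
    exact (hm q').lt_iff_lt.1 h
  · have : x q < f q a := by rw [← hg]; exact hm q ha
    filter_upwards [hx.continuousAt.eventually_lt (hq a).continuousAt this] with q' h
    rw [← hg] at h
    exact (hm q').lt_iff_lt.1 h

/-! ### The cell complex of normalized spineless cacti is compact -/

namespace TreeType

variable {n : ℕ}

/-- Each passage from an arc to the next either reaches a lobe for the first time or leaves a lobe
for the last time. Each lobe accounts for at most one passage of either kind. The bound is only
needed for finiteness. -/
theorem len_le (τ : TreeType n) : τ.len ≤ 2 * n + 1 := by
  by_contra! hlt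
  -- The passage from arc `j` to arc `j + 1` is charged to the lobe left for good (`inr`) if the new
  -- lobe was visited before, and otherwise to the new lobe (`inl`).
  let f : Fin (2 * n + 1) → Fin n ⊕ Fin n := fun j =>
    open Classical in
    if ∃ i : Fin τ.len, (i : ℕ) < j + 1 ∧ τ.lobe i = τ.lobe ⟨j + 1, by omega⟩ then
      Sum.inr (τ.lobe ⟨j, by omega⟩) else Sum.inl (τ.lobe ⟨j + 1, by omega⟩)
  have hf : Function.Injective f := by
    -- Returning to an old lobe closes off the lobe just left: a later visit `k` to it would
    -- alternate as `i < j < j + 1 < k`, against planarity.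
    have hlast : ∀ (j : Fin (2 * n + 1)) (k : Fin τ.len),
        (∃ i : Fin τ.len, (i : ℕ) < j + 1 ∧ τ.lobe i = τ.lobe ⟨j + 1, by omega⟩) →
        (j : ℕ) < k → τ.lobe k ≠ τ.lobe ⟨j, by omega⟩ := by
      rintro j k ⟨i, hi, hil⟩ hjk hk
      have hne := τ.reduced ⟨j, by omega⟩ ⟨j + 1, by omega⟩ rfl
      have h₁ : (i : ℕ) ≠ j := fun e => hne (by rw [← hil]; congr 1; exact Fin.ext e.symm)
      have h₂ : (k : ℕ) ≠ j + 1 := fun e => hne (by rw [← hk]; congr 1; exact Fin.ext e)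
      refine hne (Eq.trans ?_ hil)
      rw [τ.planar i ⟨j, by omega⟩ ⟨j + 1, by omega⟩ k (Fin.lt_def.2 (by simp; omega))
        (Fin.lt_def.2 (by simp)) (Fin.lt_def.2 (by simp; omega)) hil hk.symm]
    intro j j' hjj
    simp only [f] at hjj
    by_contra hne
    rcases lt_or_gt_of_ne (Fin.val_ne_of_ne hne) with hlt | hlt
    · split_ifs at hjj with h _ h'
      · exact hlast j ⟨j', by omega⟩ h hlt (Sum.inr_injective hjj).symm
      · exact h' ⟨⟨j + 1, by omega⟩, by simpa using hlt, Sum.inl_injective hjj⟩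
    · split_ifs at hjj with h h'
      · exact hlast j' ⟨j, by omega⟩ h' hlt (Sum.inr_injective hjj)
      · exact h ⟨⟨j' + 1, by omega⟩, by simpa using hlt, (Sum.inl_injective hjj).symm⟩
  have := Fintype.card_le_of_injective f hf
  simp at this
  omega

instance : Finite (TreeType n) := by
  let f : TreeType n → Σ k : Fin (2 * n + 2), Fin k → Fin n := fun τ =>
    ⟨⟨τ.len, Nat.lt_succ_of_le τ.len_le⟩, τ.lobe⟩
  refine Finite.of_injective f fun τ τ' h => ?_
  obtain ⟨k, u, _, _, _, _⟩ := τ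
  obtain ⟨k', u', _, _, _, _⟩ := τ'
  simp only [f, Sigma.mk.injEq, Fin.mk.injEq] at h
  obtain ⟨rfl, h⟩ := h
  cases h
  rfl

instance (τ : TreeType n) : CompactSpace τ.Cell := by
  refine isCompact_iff_compactSpace.1 (?_ : IsCompact {l : Fin τ.len → ℝ | (∀ j, 0 ≤ l j) ∧
    ∀ a, ∑ j with τ.lobe j = a, l j = 1})
  refine (isCompact_univ_pi fun _ => isCompact_Icc (a := (0 : ℝ)) (b := 1)).of_isClosed_subset
    ?_ ?_
  · have h₁ : IsClosed {l : Fin τ.len → ℝ | ∀ j, 0 ≤ l j} := by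
      simp only [Set.ofPred_forall]
      exact isClosed_iInter fun j => isClosed_le continuous_const (continuous_apply j)
    have h₂ : IsClosed {l : Fin τ.len → ℝ | ∀ a, ∑ j with τ.lobe j = a, l j = 1} := by
      simp only [Set.ofPred_forall]
      exact isClosed_iInter fun a => isClosed_eq (by fun_prop) continuous_const
    exact h₁.inter h₂
  · rintro l ⟨h₁, h₂⟩ j -
    refine ⟨h₁ j, ?_⟩
    rw [← h₂ (τ.lobe j)]
    exact Finset.single_le_sum (f := l) (fun k _ => h₁ k) (by simp)

theorem continuous_perim_cell (τ : TreeType n) (x : ℝ) (a : Fin n) :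
    Continuous fun l : τ.Cell => τ.perim l x a := by
  have h : ∀ j, Continuous fun l : τ.Cell => τ.start l j := fun j => by
    refine continuous_finsetSum _ fun i _ => ?_
    exact (continuous_apply i).comp continuous_subtype_val
  refine continuous_const.add (continuous_finsetSum _ fun j _ => ?_)
  exact (continuous_const.min (h _)).sub (continuous_const.min (h _))

theorem continuous_cellMap (τ : TreeType n) : Continuous τ.cellMap :=
  continuous_iff_coinduced_le.2 (le_iSup (fun τ : TreeType n =>
    TopologicalSpace.coinduced τ.cellMap inferInstance) τ)

end TreeType

/-! ### Subdivision of the perimeter into arcs -/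

namespace SpinelessCactus

variable {n : ℕ}

/-- The points `x 0 ≤ … ≤ x N` cut the part of the outside circle between `s` and `t` into arcs, of
which the `j`-th lies on the lobe `u j`. -/
structure IsSubdivision (c : SpinelessCactus n) (s t : ℝ) (N : ℕ) (x : ℕ → ℝ) (u : ℕ → Fin n) :
    Prop where
  first : x 0 = s
  last : x N = t
  le : ∀ j < N, x j ≤ x (j + 1)
  arc : ∀ j < N, ∀ b, b ≠ u j → c.perim (x j) b = c.perim (x (j + 1)) b

theorem exists_isSubdivision (c : SpinelessCactus n) {s t : ℝ} (hst : s ≤ t) :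
    ∃ N x u, c.IsSubdivision s t N x u := by
  classical
  let R : ℝ → ℝ → Prop := fun x y => x ≤ y ∧ ∃ a, ∀ b, b ≠ a → c.perim x b = c.perim y b
  -- Induction on the break points: one strictly between the ends splits the interval in two, any
  -- other can be discarded.
  have chain : ∀ (B : Finset ℝ) (s t : ℝ), s ≤ t → (∀ x y : ℝ, s ≤ x → x ≤ y → y ≤ t →
      (∀ b ∈ B, ¬ (x < b ∧ b < y)) → ∃ a, ∀ b, b ≠ a → c.perim x b = c.perim y b) →
      Relation.ReflTransGen R s t := by
    intro B
    induction B using Finset.induction_on with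
    | empty =>
      intro s t hst h
      exact .single ⟨hst, h s t le_rfl hst le_rfl (by simp)⟩
    | insert b B _ ih =>
      intro s t hst h
      by_cases hb : s < b ∧ b < t
      · refine (ih s b hb.1.le fun x y h₁ h₂ h₃ h₄ => ?_).trans
          (ih b t hb.2.le fun x y h₁ h₂ h₃ h₄ => ?_)
        · refine h x y h₁ h₂ (h₃.trans hb.2.le) (Finset.forall_mem_insert _ _ _ |>.2 ⟨?_, h₄⟩)
          exact fun h => absurd h.2 (not_lt.2 h₃)
        · refine h x y (hb.1.le.trans h₁) h₂ h₃ (Finset.forall_mem_insert _ _ _ |>.2 ⟨?_, h₄⟩)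
          exact fun h => absurd h.1 (not_lt.2 h₁)
      · refine ih s t hst fun x y h₁ h₂ h₃ h₄ => ?_
        refine h x y h₁ h₂ h₃ (Finset.forall_mem_insert _ _ _ |>.2 ⟨?_, h₄⟩)
        exact fun h => hb ⟨h₁.trans_lt h.1, h.2.trans_le h₃⟩
  obtain ⟨B, hB⟩ := c.finite_arcs s t
  refine Relation.ReflTransGen.head_induction_on (chain B s t hst hB) ?_ ?_
  · exact ⟨0, fun _ => t, fun _ => ⟨0, c.pos⟩, rfl, rfl, by simp, by simp⟩
  · rintro s s' ⟨hs, a, ha⟩ - ⟨N, x, u, hx⟩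
    refine ⟨N + 1, fun j => Nat.casesOn j s x, fun j => Nat.casesOn j a u, rfl, hx.last, ?_, ?_⟩
    · rintro (_ | j) hj
      · simpa [hx.first] using hs
      · exact hx.le j (by omega)
    · rintro (_ | j) hj
      · simpa [hx.first] using ha
      · exact hx.arc j (by omega)

/-- An arc of length zero can be dropped, and two consecutive arcs on the same lobe can be merged.
Both are done by removing the cut point `x (j + 1)` and the label `u j`. -/
theorem IsSubdivision.erase {c : SpinelessCactus n} {s t : ℝ} {N : ℕ} {x : ℕ → ℝ} {u : ℕ → Fin n}
    (h : c.IsSubdivision s t (N + 1) x u) {j : ℕ} (hj : j < N + 1)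
    (h' : x j = x (j + 1) ∨ j + 1 < N + 1 ∧ u j = u (j + 1)) :
    ∃ x' u', c.IsSubdivision s t N x' u' := by
  refine ⟨fun k => if k ≤ j then x k else x (k + 1), fun k => if k < j then u k else u (k + 1),
    by simp [h.first], ?_, fun k hk => ?_, fun k hk b hb => ?_⟩
  · split_ifs with hN
    · obtain rfl : j = N := by omega
      rcases h' with h' | h'
      · rw [h', h.last]
      · omega
    · exact h.last
  · split_ifs
    · exact h.le k (by omega)
    · exact (h.le k (by omega)).trans (h.le (k + 1) (by omega))
    · omega
    · exact h.le (k + 1) (by omega)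
  · split_ifs at hb ⊢ <;> first | omega | skip
    · exact h.arc k (by omega) b hb
    · obtain rfl : k = j := by omega
      rcases h' with h' | h'
      · rw [h']; exact h.arc (k + 1) (by omega) b hb
      · rw [h.arc k (by omega) b (h'.2 ▸ hb), h.arc (k + 1) (by omega) b hb]
    · exact h.arc (k + 1) (by omega) b hb

/-- A subdivision with the least number of arcs has no empty arc and no two consecutive arcs on one
lobe, as otherwise `erase` would shorten it. -/
theorem exists_reduced_isSubdivision (c : SpinelessCactus n) {s t : ℝ} (hst : s ≤ t) :
    ∃ N x u, c.IsSubdivision s t N x u ∧ (∀ j < N, x j < x (j + 1)) ∧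
      ∀ j, j + 1 < N → u j ≠ u (j + 1) := by
  classical
  have hex := c.exists_isSubdivision hst
  have hmin := fun m => Nat.find_min (m := m) hex
  obtain ⟨x, u, h⟩ := Nat.find_spec hex
  generalize Nat.find hex = N at hmin h
  rcases N with _ | N
  · exact ⟨0, x, u, h, by simp, by simp⟩
  refine ⟨N + 1, x, u, h, fun j hj => (h.le j hj).lt_of_ne fun e => ?_, fun j hj e => ?_⟩
  · exact hmin N (Nat.lt_succ_self N) (h.erase hj (Or.inl e))
  · exact hmin N (Nat.lt_succ_self N) (h.erase (j := j) (by omega) (Or.inr ⟨hj, e⟩))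

theorem IsSubdivision.monotone {c : SpinelessCactus n} {s t : ℝ} {N : ℕ} {x : ℕ → ℝ}
    {u : ℕ → Fin n} (h : c.IsSubdivision s t N x u) {j k : ℕ} (hjk : j ≤ k) (hk : k ≤ N) :
    x j ≤ x k := by
  induction k, hjk using Nat.le_induction with
  | base => exact le_rfl
  | succ k _ ih => exact (ih (by omega)).trans (h.le k (by omega))

/-- On each of its arcs the perimeter of a normalized cactus has constant speed. -/
theorem IsSubdivision.perim_sub {c : SpinelessCactus n} (hc : ∀ a, c.radius a = 1) {s t : ℝ}
    {N : ℕ} {x : ℕ → ℝ} {u : ℕ → Fin n} (h : c.IsSubdivision s t N x u) {j : ℕ} (hj : j < N)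
    {y z : ℝ} (hy : x j ≤ y) (hyz : y ≤ z) (hz : z ≤ x (j + 1)) (a : Fin n) :
    c.perim z a - c.perim y a = if u j = a then n * (z - y) else 0 := by
  have h₀ : ∀ b, b ≠ u j → c.perim z b - c.perim y b = 0 := by
    intro b hb
    have h₁ : c.perim (x j) b ≤ c.perim y b := c.mono b hy
    have h₂ : c.perim y b ≤ c.perim z b := c.mono b hyz
    have h₃ : c.perim z b ≤ c.perim (x (j + 1)) b := c.mono b hz
    have := h.arc j hj b hb
    linarith
  split_ifs with hja
  · subst hja
    have h₁ := c.arclength z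
    have h₂ := c.arclength y
    simp only [hc, one_mul, Finset.sum_const, Finset.card_univ, Fintype.card_fin, nsmul_eq_mul,
      mul_one] at h₁ h₂
    rw [mul_sub, ← h₁, ← h₂, ← Finset.sum_sub_distrib]
    exact (Finset.sum_eq_single (u j) (fun b _ hb => h₀ b hb) (by simp)).symm
  · exact h₀ a (fun e => hja e.symm)

end SpinelessCactus

theorem NormalizedSpinelessCactus.eq_of_perim {n : ℕ} {c c' : NormalizedSpinelessCactus n}
    (h : ∀ x, c.1.perim x = c'.1.perim x) : c = c' :=
  Subtype.ext (SpinelessCactus.ext (funext fun a => (c.2 a).trans (c'.2 a).symm) (funext h))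

namespace TreeType

variable {n : ℕ}

/-- The closed cells cover. The tree is the sequence of lobes in a reduced subdivision of one turn,
and the arc lengths are the parameter lengths times `n`, the length of the outside circle. -/
theorem exists_cellMap_eq (c : NormalizedSpinelessCactus n) :
    ∃ (τ : TreeType n) (l : τ.Cell), τ.cellMap l = c := by
  obtain ⟨c, hc⟩ := c
  have hn : (0 : ℝ) < n := Nat.cast_pos.mpr c.pos
  obtain ⟨N, x, u, h, hlt, hred⟩ := c.exists_reduced_isSubdivision zero_le_one
  have hmove : ∀ j k : ℕ, j < k → k ≤ N → c.perim (x j) (u j) < c.perim (x k) (u j) := by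
    intro j k hjk hk
    have h₁ := h.perim_sub hc (j := j) (by omega) le_rfl (h.le j (by omega)) le_rfl (u j)
    rw [if_pos rfl] at h₁
    have h₂ : c.perim (x (j + 1)) (u j) ≤ c.perim (x k) (u j) :=
      c.mono _ (h.monotone (by omega) hk)
    have h₃ := mul_pos hn (sub_pos.2 (hlt j (by omega)))
    linarith
  -- the part of the perimeter up to `y`, cut into its arcs
  have hstep : ∀ (y : ℝ) (j : ℕ) (a : Fin n), j < N →
      c.perim (min y (x (j + 1))) a - c.perim (min y (x j)) a =
        if u j = a then n * (min y (x (j + 1)) - min y (x j)) else 0 := by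
    intro y j a hj
    have hle := h.le j hj
    rcases le_total y (x j) with hy | hy
    · rw [min_eq_left hy, min_eq_left (hy.trans hle)]; simp
    · rw [min_eq_right hy]
      exact h.perim_sub hc hj le_rfl (le_min hy hle) (min_le_right _ _) a
  -- The cut points truncated at `y` run from `0` to `y`, so the increments of the perimeter along
  -- them telescope.
  have hsum : ∀ (y : ℝ) (a : Fin n), 0 ≤ y → y ≤ 1 → ∑ j ∈ Finset.univ.filter (fun j : Fin N => u j = a),
      n * (min y (x (j + 1)) - min y (x j)) = c.perim y a := by
    intro y a h₀ h₁
    rw [Finset.sum_filter, Fin.sum_univ_eq_sum_range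
      (fun j => if u j = a then n * (min y (x (j + 1)) - min y (x j)) else 0) N,
      ← Finset.sum_congr rfl (fun j hj => hstep y j a (Finset.mem_range.1 hj)),
      Finset.sum_range_sub (fun j => c.perim (min y (x j)) a), h.first, h.last, min_eq_left h₁,
      min_eq_right h₀, c.perim_zero, sub_zero]
  have hx : ∀ j ≤ N, 0 ≤ x j ∧ x j ≤ 1 := fun j hj =>
    ⟨h.first ▸ h.monotone (Nat.zero_le j) hj, h.last ▸ h.monotone hj le_rfl⟩
  let τ : TreeType n :=
    { len := N
      lobe := fun j => u j
      pos := c.pos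
      surjective := by
        intro a
        by_contra! hne
        have h₁ := hsum 1 a zero_le_one le_rfl
        rw [Finset.filter_false_of_mem (fun j _ => hne j), Finset.sum_empty] at h₁
        have h₂ := c.perim_add_one 0 a
        rw [zero_add, c.perim_zero] at h₂
        linarith
      reduced := by
        intro j j' hj
        simp only [hj]
        exact hred j (by omega)
      planar := by
        intro j₁ j₂ j₃ j₄ h₁ h₂ h₃ h₁₃ h₂₄
        by_contra hne
        -- Alternating labels would make the perimeter alternate between two lobes: on the way from
        -- the start of each chosen arc to the next point it moves strictly on that arc's lobe, and
        -- all five points lie in one turn.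
        refine c.treeLike _ _ hne (x j₁) (x j₂) (x j₃) (x j₄) (x (j₄ + 1)) ?_
          ⟨hmove _ _ h₁ (by omega), hmove _ _ h₂ (by omega), ?_, ?_⟩
        · have := hx (j₄ + 1) (by omega)
          have := hx j₁ (by omega)
          linarith
        · simp only [h₁₃]; exact hmove _ _ h₃ (by omega)
        · simp only [h₂₄]; exact hmove _ _ (Nat.lt_succ_self _) (by omega) }
  let l : τ.Cell := ⟨fun j => n * (x (j + 1) - x j),
    fun j => mul_nonneg hn.le (sub_nonneg.2 (h.le j j.2)), fun a => by
      have h₁ := hsum 1 a zero_le_one le_rfl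
      have h₂ := c.perim_add_one 0 a
      rw [zero_add, c.perim_zero] at h₂
      rw [h₂, zero_add] at h₁
      rw [← h₁]
      refine Finset.sum_congr rfl fun j _ => ?_
      rw [min_eq_right (hx _ (Nat.succ_le_of_lt j.2)).2, min_eq_right (hx _ (le_of_lt j.2)).2]⟩
  have hstart : ∀ j ≤ N, τ.start l j = n * x j := by
    intro j
    induction j with
    | zero => intro _; rw [start_zero, h.first, mul_zero]
    | succ j ih =>
      intro hj
      have := τ.start_succ l ⟨j, hj⟩
      rw [ih (by omega)] at this
      rw [this]
      simp only [l]
      ring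
  refine ⟨τ, l, NormalizedSpinelessCactus.eq_of_perim fun y => funext fun a => ?_⟩
  have h₁ : ∀ (y : ℝ) (k : ℤ), c.perim (y + k) a = c.perim y a + k := by
    intro y k
    induction k using Int.induction_on with
    | zero => simp
    | succ k ih => push_cast at ih ⊢; rw [← add_assoc, c.perim_add_one, ih, add_assoc]
    | pred k ih =>
      have := c.perim_add_one (y + ((-(k : ℤ) - 1 : ℤ) : ℝ)) a
      push_cast at ih this ⊢
      rw [show y + (-(k : ℝ) - 1) + 1 = y + -k by ring, ih] at this
      linarith
  change τ.perim l y a = c.perim y a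
  have h₂ : τ.travelled l (n * Int.fract y) a = c.perim (Int.fract y) a := by
    rw [← hsum _ a (Int.fract_nonneg y) (Int.fract_lt_one y).le]
    refine Finset.sum_congr rfl fun j _ => ?_
    rw [hstart _ (Nat.succ_le_of_lt j.2), hstart _ (le_of_lt j.2),
      ← mul_min_of_nonneg _ _ hn.le, ← mul_min_of_nonneg _ _ hn.le, mul_sub]
  rw [perim, h₂, add_comm, ← h₁, Int.fract_add_floor]

end TreeType

namespace NormalizedSpinelessCactus

variable {n : ℕ}

/-- A finite union of continuous images of compact cells. -/
instance : CompactSpace (NormalizedSpinelessCactus n) := by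
  refine ⟨?_⟩
  have : (Set.univ : Set (NormalizedSpinelessCactus n)) =
      ⋃ τ : TreeType n, Set.range τ.cellMap := by
    refine (Set.eq_univ_of_forall fun c => ?_).symm
    obtain ⟨τ, l, h⟩ := TreeType.exists_cellMap_eq c
    exact Set.mem_iUnion.2 ⟨τ, l, h⟩
  rw [this]
  exact isCompact_iUnion fun τ => isCompact_range τ.continuous_cellMap

/-- The topology of the cell complex of normalized spineless cacti is that of pointwise
convergence of the perimeters. -/
theorem isClosedEmbedding_perim :
    IsClosedEmbedding fun c : NormalizedSpinelessCactus n => c.1.perim := by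
  -- The source is compact and the space of functions is Hausdorff, so continuity and injectivity
  -- suffice; by the coinduced topology, continuity is checked on each cell.
  refine Continuous.isClosedEmbedding ?_ fun c c' h => eq_of_perim (congrFun h)
  refine continuous_iSup_dom.2 fun τ => continuous_coinduced_dom.2 ?_
  exact continuous_pi fun x => continuous_pi fun a => τ.continuous_perim_cell x a

theorem continuous_iff {Q : Type*} [TopologicalSpace Q] {f : Q → NormalizedSpinelessCactus n} :
    Continuous f ↔ ∀ x, Continuous fun q => (f q).1.perim x := by
  rw [isClosedEmbedding_perim.isInducing.continuous_iff, continuous_pi_iff]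
  rfl

end NormalizedSpinelessCactus

/-- The projection from the line to the circle is open, which is what keeps it a quotient map after
taking the product with `Y`. -/
theorem continuous_of_circle_prod {Y Z : Type*} [TopologicalSpace Y] [TopologicalSpace Z]
    {f : UnitAddCircle × Y → Z}
    (hf : Continuous fun z : ℝ × Y => f ((z.1 : UnitAddCircle), z.2)) : Continuous f := by
  have hq : IsOpenQuotientMap (Prod.map (fun t : ℝ => (t : UnitAddCircle)) (id : Y → Y)) :=
    (QuotientAddGroup.isOpenQuotientMap_mk (N := AddSubgroup.zmultiples (1 : ℝ))).prodMap
      IsOpenQuotientMap.id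
  exact hq.isQuotientMap.continuous_iff.2 hf

/-! ### Rescaling and gluing in terms of the path of the perimeter -/

namespace SpinelessCactus

variable {n : ℕ}

/-- The perimeter of `c` is, up to a change of its parameter, that of `c'`. -/
def SamePath (c c' : SpinelessCactus n) : Prop := ∀ x, ∃ y, c.perim x = c'.perim y

theorem SamePath.trans {c c' c'' : SpinelessCactus n} (h : c.SamePath c') (h' : c'.SamePath c'') :
    c.SamePath c'' := by
  intro x
  obtain ⟨y, hy⟩ := h x
  obtain ⟨z, hz⟩ := h' y
  exact ⟨z, hy.trans hz⟩

/-- The sum of the lobe angles weighted by the radii is the total length times the outside angle, so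
a point of the path and the radii determine the parameter. -/
theorem SamePath.eq {c c' : SpinelessCactus n} (h : c.SamePath c') (hr : c.radius = c'.radius) :
    c = c' := by
  refine SpinelessCactus.ext hr (funext fun x => ?_)
  obtain ⟨y, hy⟩ := h x
  have h₁ := c.arclength x
  rw [hy, hr, c'.arclength] at h₁
  rw [hy, mul_left_cancel₀ c'.total_pos.ne' h₁]

/-- Exposes the inverse of the clock hidden in `rescale`, together with the equation that
characterizes it. -/
theorem exists_rescale_perim (c : SpinelessCactus n) (s : Fin n → ℝ) (hs : ∀ a, 0 < s a) (x : ℝ) :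
    ∃ y, (c.rescale s hs).perim x = c.perim y ∧ c.clock s y = x := by
  let e : ℝ ≃o ℝ := StrictMono.orderIsoOfSurjective (c.clock s) (c.clock_bijective s hs).1
    (c.clock_bijective s hs).2
  exact ⟨e.symm x, rfl, e.apply_symm_apply x⟩

theorem rescale_samePath (c : SpinelessCactus n) (s : Fin n → ℝ) (hs : ∀ a, 0 < s a) :
    (c.rescale s hs).SamePath c := fun x =>
  (c.exists_rescale_perim s hs x).imp fun _ h => h.1

theorem rescale_perim_clock (c : SpinelessCactus n) (s : Fin n → ℝ) (hs : ∀ a, 0 < s a) (y : ℝ) :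
    (c.rescale s hs).perim (c.clock s y) = c.perim y := by
  obtain ⟨y', h, hy⟩ := c.exists_rescale_perim s hs (c.clock s y)
  rw [h, (c.clock_bijective s hs).1.injective hy]

theorem samePath_rescale (c : SpinelessCactus n) (s : Fin n → ℝ) (hs : ∀ a, 0 < s a) :
    c.SamePath (c.rescale s hs) := fun y => ⟨_, (c.rescale_perim_clock s hs y).symm⟩

theorem rescale_eq_self (c : SpinelessCactus n) (s : Fin n → ℝ) (hs : ∀ a, 0 < s a)
    (h : s = c.radius) : c.rescale s hs = c :=
  (c.rescale_samePath s hs).eq h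

theorem rescale_rescale (c : SpinelessCactus n) (s s' : Fin n → ℝ) (hs : ∀ a, 0 < s a)
    (hs' : ∀ a, 0 < s' a) : (c.rescale s hs).rescale s' hs' = c.rescale s' hs' :=
  (((rescale_samePath _ s' hs').trans (rescale_samePath _ s hs)).trans
    (samePath_rescale _ s' hs')).eq rfl

/-- The glued perimeter sees the parameter only through the perimeter of the outer cactus, so
reparametrizing the latter does not change the path. Nothing of the kind holds for the inner cactus,
whose outside parametrization matters. -/
theorem SamePath.glue {m p : ℕ} (h : m + n = p + 1) (i : Fin m) {c d : SpinelessCactus m}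
    (hcd : c.SamePath d) (c' : SpinelessCactus n) : (c.glue h i c').SamePath (d.glue h i c') := by
  intro x
  obtain ⟨y, hy⟩ := hcd x
  exact ⟨y, by simp only [SpinelessCactus.glue, hy]⟩

theorem SamePath.smul {c d : SpinelessCactus n} (h : c.SamePath d) (σ : Equiv.Perm (Fin n)) :
    (σ • c).SamePath (σ • d) := by
  intro x
  obtain ⟨y, hy⟩ := h x
  exact ⟨y, funext fun b => congrFun hy (σ⁻¹ b)⟩

theorem smul_radius (σ : Equiv.Perm (Fin n)) (c : SpinelessCactus n) :
    (σ • c).radius = fun b => c.radius (σ⁻¹ b) := rfl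

theorem smul_perim (σ : Equiv.Perm (Fin n)) (c : SpinelessCactus n) (x : ℝ) :
    (σ • c).perim x = fun b => c.perim x (σ⁻¹ b) := rfl

theorem glue_radius {m p : ℕ} (h : m + n = p + 1) (i : Fin m) (c : SpinelessCactus m)
    (c' : SpinelessCactus n) : (c.glue h i c').radius =
      splice h i c.radius (fun k => c.radius i / (∑ l, c'.radius l) * c'.radius k) := rfl

theorem glue_perim {m p : ℕ} (h : m + n = p + 1) (i : Fin m) (c : SpinelessCactus m)
    (c' : SpinelessCactus n) (x : ℝ) :
    (c.glue h i c').perim x = splice h i (c.perim x) (c'.perim (c.perim x i)) := rfl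

theorem smul_rescale (σ : Equiv.Perm (Fin n)) (c : SpinelessCactus n) (s s' : Fin n → ℝ)
    (hs : ∀ a, 0 < s a) (hs' : ∀ a, 0 < s' a) (h : s' = fun b => s (σ⁻¹ b)) :
    (σ • c).rescale s' hs' = σ • c.rescale s hs :=
  ((rescale_samePath _ s' hs').trans ((samePath_rescale c s hs).smul σ)).eq h

theorem sum_smul_radius (σ : Equiv.Perm (Fin n)) (c : SpinelessCactus n) :
    ∑ b, (σ • c).radius b = ∑ b, c.radius b :=
  Equiv.sum_comp σ⁻¹ c.radius

theorem smul_glue {m p : ℕ} (h : m + n = p + 1) (i : Fin m) (σ : Equiv.Perm (Fin m))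
    (τ : Equiv.Perm (Fin n)) (c : SpinelessCactus m) (c' : SpinelessCactus n) :
    (σ • c).glue h (σ i) (τ • c') = blockPerm h i σ τ • c.glue h i c' := by
  have hσ : σ⁻¹ (σ i) = i := by rw [← Equiv.Perm.mul_apply, inv_mul_cancel, Equiv.Perm.one_apply]
  refine SpinelessCactus.ext ?_ (funext fun x => ?_)
  · rw [glue_radius, sum_smul_radius]
    simp only [smul_radius, hσ]
    exact splice_perm h i σ τ c.radius (fun k => c.radius i / (∑ l, c'.radius l) * c'.radius k)
  · rw [glue_perim]
    simp only [smul_perim, hσ]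
    exact splice_perm h i σ τ (c.perim x) (c'.perim (c.perim x i))

theorem glue_nested {k l m p q r : ℕ} (h₁ : k + l = p + 1) (h₂ : p + m = r + 1)
    (h₃ : l + m = q + 1) (h₄ : k + q = r + 1) (i : Fin k) (j : Fin l) (j' : Fin p)
    (hj : (j' : ℕ) = i + j) (a : SpinelessCactus k) (b : SpinelessCactus l)
    (c : SpinelessCactus m) :
    (a.glue h₁ i b).glue h₂ j' c = a.glue h₄ i (b.glue h₃ j c) := by
  refine SpinelessCactus.ext ?_ (funext fun x => ?_)
  · have hsum : ∑ s, (b.glue h₃ j c).radius s = ∑ s, b.radius s := by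
      rw [glue_radius, sum_slot h₃ j _ b.radius (fun k => b.radius j / (∑ l, c.radius l) *
        c.radius k) (by simp) (by simp), ← Finset.mul_sum, div_mul_cancel₀ _ c.total_pos.ne',
        sub_add_cancel]
    rw [glue_radius h₂, glue_radius h₄, hsum, glue_radius, splice_apply_of_eq h₁ i j _ _ j' hj,
      splice_nested h₁ h₂ h₃ h₄ i j j' hj]
    congr 1
    funext s
    rw [glue_radius, map_splice (fun x => a.radius i / (∑ s, b.radius s) * x)]
    congr 1
    funext s
    ring
  · simp only [glue_perim]
    rw [splice_apply_of_eq h₁ i j _ _ j' hj, splice_nested h₁ h₂ h₃ h₄ i j j' hj]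

theorem glue_parallel {k l m p q r : ℕ} (h₁ : k + l = p + 1) (h₂ : p + m = r + 1)
    (h₃ : k + m = q + 1) (h₄ : q + l = r + 1) (i j : Fin k) (j' : Fin p) (i' : Fin q)
    (hji : j < i) (hj : (j' : ℕ) = j) (hi : (i' : ℕ) + 1 = i + m) (a : SpinelessCactus k)
    (b : SpinelessCactus l) (c : SpinelessCactus m) :
    (a.glue h₁ i b).glue h₂ j' c = (a.glue h₃ j c).glue h₄ i' b := by
  refine SpinelessCactus.ext ?_ (funext fun x => ?_)
  · simp only [glue_radius]
    rw [splice_apply_of_lt h₁ i j _ _ j' hji hj, splice_apply_of_gt h₃ j i _ _ i' hji hi,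
      splice_parallel h₁ h₂ h₃ h₄ i j j' i' hji hj hi]
  · simp only [glue_perim]
    rw [splice_apply_of_lt h₁ i j _ _ j' hji hj, splice_apply_of_gt h₃ j i _ _ i' hji hi,
      splice_parallel h₁ h₂ h₃ h₄ i j j' i' hji hj hi]

/-! ### Continuity -/

section

variable {Q : Type*} [TopologicalSpace Q]

/-- Monotonicity in the outside angle turns pointwise continuity of a family of perimeters into
continuity at a moving angle. -/
theorem continuous_perim_comp {f : Q → SpinelessCactus n}
    (hf : ∀ x, Continuous fun q => (f q).perim x) {g : Q → ℝ} (hg : Continuous g) :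
    Continuous fun q => (f q).perim (g q) := by
  refine continuous_pi fun a => ?_
  exact (continuous_uncurry_of_monotone (f := fun q x => (f q).perim x a) (fun q => (f q).mono a)
    (fun q => (f q).continuous_perim a) (fun x => (continuous_apply a).comp (hf x))).comp
    (continuous_id.prodMk hg)

/-- The rescaled perimeter is the old one evaluated at the solution of `clock = x`, and this
solution varies continuously because the clocks are strictly monotone. -/
theorem continuous_rescale_perim {f : Q → SpinelessCactus n}
    (hf : ∀ x, Continuous fun q => (f q).perim x) {s : Q → Fin n → ℝ} (hs : Continuous s)
    (hpos : ∀ q a, 0 < s q a) (x : ℝ) :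
    Continuous fun q => ((f q).rescale (s q) (hpos q)).perim x := by
  choose g hg hgx using fun q => (f q).exists_rescale_perim (s q) (hpos q) x
  simp only [hg]
  refine continuous_perim_comp hf (continuous_solution_of_strictMono
    (f := fun q y => (f q).clock (s q) y) (fun q => ((f q).clock_bijective (s q) (hpos q)).1)
    (fun y => ?_) continuous_const hgx)
  have h₁ : ∀ a, Continuous fun q => s q a := fun a => (continuous_apply a).comp hs
  refine (continuous_finsetSum _ fun a _ => (h₁ a).mul ((continuous_apply a).comp (hf y))).div
    (continuous_finsetSum _ fun a _ => h₁ a) fun q => ?_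
  exact (Finset.sum_pos (fun a _ => hpos q a) ⟨⟨0, (f q).pos⟩, Finset.mem_univ _⟩).ne'

/-- The topology of the space of spineless cacti is that of convergence of the radii and pointwise
convergence of the perimeters. -/
theorem continuous_iff {f : Q → SpinelessCactus n} : Continuous f ↔
    (Continuous fun q => (f q).radius) ∧ ∀ x, Continuous fun q => (f q).perim x := by
  have h : Continuous f ↔ (Continuous fun q => (f q).normalize) ∧
      Continuous fun q => (f q).radius := by
    rw [continuous_induced_rng, ← continuous_prodMk]
    rfl
  rw [h, NormalizedSpinelessCactus.continuous_iff]
  refine ⟨fun ⟨h₁, h₂⟩ => ⟨h₂, fun x => ?_⟩, fun ⟨h₁, h₂⟩ => ⟨fun x => ?_, h₁⟩⟩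
  -- Each cactus is recovered by rescaling its normalization to its own radii.
  · convert continuous_rescale_perim h₁ h₂ (fun q => (f q).radius_pos) x using 3 with q
    have : (f q).normalize.1.rescale (f q).radius (f q).radius_pos = f q :=
      (rescale_rescale _ _ _ _ _).trans (rescale_eq_self _ _ _ rfl)
    rw [this]
  · exact continuous_rescale_perim h₂ continuous_const (fun _ _ => one_pos) x

theorem continuous_radius : Continuous fun c : SpinelessCactus n => c.radius :=
  (continuous_iff.1 continuous_id).1

theorem continuous_perim_apply (x : ℝ) : Continuous fun c : SpinelessCactus n => c.perim x :=
  (continuous_iff.1 continuous_id).2 x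

theorem continuous_perim_eval :
    Continuous fun q : SpinelessCactus n × ℝ => q.1.perim q.2 :=
  continuous_perim_comp (fun x => (continuous_perim_apply x).comp continuous_fst) continuous_snd

theorem continuous_smul (σ : Equiv.Perm (Fin n)) :
    Continuous fun c : SpinelessCactus n => σ • c := by
  refine continuous_iff.2 ⟨continuous_pi fun b => ?_, fun x => continuous_pi fun b => ?_⟩
  · exact (continuous_apply (σ⁻¹ b)).comp continuous_radius
  · exact (continuous_apply (σ⁻¹ b)).comp (continuous_perim_apply x)

theorem continuous_rescale {f : Q → SpinelessCactus n} (hf : Continuous f) {s : Q → Fin n → ℝ}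
    (hs : Continuous s) (hpos : ∀ q a, 0 < s q a) :
    Continuous fun q => (f q).rescale (s q) (hpos q) :=
  continuous_iff.2 ⟨hs, continuous_rescale_perim (continuous_iff.1 hf).2 hs hpos⟩

theorem continuous_glue {m p : ℕ} (h : m + n = p + 1) (i : Fin m) {f : Q → SpinelessCactus m}
    {g : Q → SpinelessCactus n} (hf : Continuous f) (hg : Continuous g) :
    Continuous fun q => (f q).glue h i (g q) := by
  obtain ⟨hf₁, hf₂⟩ := continuous_iff.1 hf
  obtain ⟨hg₁, hg₂⟩ := continuous_iff.1 hg
  refine continuous_iff.2 ⟨?_, fun x => ?_⟩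
  · refine continuous_splice h i hf₁ (continuous_pi fun k => ?_)
    refine Continuous.mul (((continuous_apply i).comp hf₁).div
      (continuous_finsetSum _ fun l _ => (continuous_apply l).comp hg₁)
      fun q => (g q).total_pos.ne') ((continuous_apply k).comp hg₁)
  · exact continuous_splice h i (hf₂ x)
      (continuous_perim_comp hg₂ ((continuous_apply i).comp (hf₂ x)))

theorem continuous_rotate {θ : Q → UnitAddCircle} {f : Q → SpinelessCactus n} (hθ : Continuous θ)
    (hf : Continuous f) : Continuous fun q => (f q).rotate (θ q) := by
  have h : Continuous fun q : UnitAddCircle × SpinelessCactus n => q.2.rotate q.1 := by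
    -- It suffices to rotate by real angles, where the new perimeter is a difference of two values
    -- of the old one at moving angles.
    refine continuous_of_circle_prod ?_
    change Continuous fun z : ℝ × SpinelessCactus n => z.2.rotateBy z.1
    have h₀ : Continuous fun z : ℝ × SpinelessCactus n => z.2.radius :=
      continuous_radius.comp continuous_snd
    refine continuous_iff.2 ⟨h₀, fun x => ?_⟩
    have h₁ : Continuous fun z : ℝ × SpinelessCactus n => z.2.perim (x - z.1) :=
      continuous_perim_eval.comp (continuous_snd.prodMk (continuous_const.sub continuous_fst))
    have h₂ : Continuous fun z : ℝ × SpinelessCactus n => z.2.perim (-z.1) :=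
      continuous_perim_eval.comp (continuous_snd.prodMk continuous_fst.neg)
    exact h₁.sub h₂
  exact h.comp (hθ.prodMk hf)

end

theorem rotate_zero (c : SpinelessCactus n) : c.rotate 0 = c := by
  change c.rotateBy 0 = c
  refine SpinelessCactus.ext rfl (funext fun x => funext fun a => ?_)
  simp [rotateBy, c.perim_zero]

theorem smul_rotate (σ : Equiv.Perm (Fin n)) (θ : UnitAddCircle) (c : SpinelessCactus n) :
    (σ • c).rotate θ = σ • c.rotate θ := by
  induction θ using QuotientAddGroup.induction_on with
  | H t => rfl

end SpinelessCactus

/-! ### The operad of spineless cacti and the quasi-operad of normalized ones -/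

namespace NormalizedSpinelessCactus

variable {n : ℕ} {Q : Type*} [TopologicalSpace Q]

/-- The cell topology coincides with the subspace topology inside all spineless cacti: both are
pointwise convergence of perimeters, the radii being constant. Continuity statements for normalized
cacti thus follow from those for all cacti. -/
theorem continuous_iff_val {f : Q → NormalizedSpinelessCactus n} :
    Continuous f ↔ Continuous fun q => (f q).1 := by
  rw [continuous_iff, SpinelessCactus.continuous_iff]
  refine ⟨fun h => ⟨?_, h⟩, fun h => h.2⟩
  convert continuous_const (y := fun _ : Fin n => (1 : ℝ)) with q
  exact (f q).2 _

theorem continuous_val : Continuous fun c : NormalizedSpinelessCactus n => c.1 :=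
  continuous_iff_val.1 continuous_id

end NormalizedSpinelessCactus

theorem stretch_perm {m : ℕ} (n : ℕ) (i : Fin m) (σ : Equiv.Perm (Fin m)) :
    stretch (σ i) n = fun b => stretch i n (σ⁻¹ b) := by
  funext b
  obtain ⟨b, rfl⟩ := σ.surjective b
  rw [← Equiv.Perm.mul_apply, inv_mul_cancel, Equiv.Perm.one_apply]
  simp [stretch, Function.update_apply]

theorem NormalizedSpinelessCactus.smul_glue {m n p : ℕ} (h : m + n = p + 1) (i : Fin m)
    (σ : Equiv.Perm (Fin m)) (τ : Equiv.Perm (Fin n)) (c : NormalizedSpinelessCactus m)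
    (c' : NormalizedSpinelessCactus n) :
    (σ • c).glue h (σ i) (τ • c') = blockPerm h i σ τ • c.glue h i c' := by
  refine Subtype.ext ?_
  change ((σ • c.1).rescale _ _).glue h (σ i) (τ • c'.1) =
    blockPerm h i σ τ • (c.1.rescale _ _).glue h i c'.1
  rw [SpinelessCactus.smul_rescale σ c.1 (stretch i n) (stretch (σ i) n)
    (stretch_pos i c'.1.pos) _ (stretch_perm n i σ), SpinelessCactus.smul_glue]

theorem NormalizedSpinelessCactus.continuous_glue {m n p : ℕ} (h : m + n = p + 1) (i : Fin m)
    {Q : Type*} [TopologicalSpace Q] {f : Q → NormalizedSpinelessCactus m}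
    {g : Q → NormalizedSpinelessCactus n} (hf : Continuous f) (hg : Continuous g) :
    Continuous fun q => (f q).glue h i (g q) :=
  continuous_iff_val.2 (SpinelessCactus.continuous_glue h i
    (SpinelessCactus.continuous_rescale (continuous_iff_val.1 hf) continuous_const _)
    (continuous_iff_val.1 hg))

theorem isOperad_cact : IsOperad Cact cactComp where
  continuous_act _ σ := SpinelessCactus.continuous_smul σ
  continuous_comp _ _ _ h i := SpinelessCactus.continuous_glue h i continuous_fst continuous_snd
  equivariant _ _ _ h i σ τ a b := SpinelessCactus.smul_glue h i σ τ a b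
  assoc_nested _ _ _ _ _ _ h₁ h₂ h₃ h₄ i j j' hj a b c :=
    SpinelessCactus.glue_nested h₁ h₂ h₃ h₄ i j j' hj a b c
  assoc_parallel _ _ _ _ _ _ h₁ h₂ h₃ h₄ i j j' i' hji hj hi a b c :=
    SpinelessCactus.glue_parallel h₁ h₂ h₃ h₄ i j j' i' hji hj hi a b c

theorem isQuasiOperad_ncact : IsQuasiOperad NCact ncactComp where
  continuous_act _ σ := NormalizedSpinelessCactus.continuous_iff_val.2
    ((SpinelessCactus.continuous_smul σ).comp NormalizedSpinelessCactus.continuous_val)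
  continuous_comp _ _ _ h i :=
    NormalizedSpinelessCactus.continuous_glue h i continuous_fst continuous_snd
  equivariant _ _ _ h i σ τ a b := NormalizedSpinelessCactus.smul_glue h i σ τ a b

/-! ### The homotopy diagonal and its linear deformation -/

namespace SpinelessCactus

variable {n : ℕ}

/-- The orientation reversed perimeter, deformed linearly to the diagonal of `(S^1)^n`: at time `t`
the lobe `a` is run through with the angle `t * perim x a + (1 - t) * x`. -/
noncomputable def diagonalHomotopy (c : SpinelessCactus n) (t : ℝ) (θ : UnitAddCircle) :
    Fin n → UnitAddCircle := fun a =>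
  -(Function.Periodic.lift (f := fun x => ((t * c.perim x a + (1 - t) * x : ℝ) : UnitAddCircle))
    (c := 1) (by
      intro x
      -- Both lifts gain `1` in each turn, hence so does their affine combination, which therefore
      -- descends to the circle.
      have : t * (c.perim x a + 1) + (1 - t) * (x + 1) = t * c.perim x a + (1 - t) * x + 1 := by
        ring
      simp only [c.perim_add_one, this, AddCircle.coe_add, AddCircle.coe_period, add_zero]) (-θ))

theorem diagonalHomotopy_coe (c : SpinelessCactus n) (t x : ℝ) (a : Fin n) :
    c.diagonalHomotopy t (x : UnitAddCircle) a =
      -((t * c.perim (-x) a + (1 - t) * -x : ℝ) : UnitAddCircle) := rfl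

theorem outer_coe (c : SpinelessCactus n) (x : ℝ) (a : Fin n) :
    c.outer (x : UnitAddCircle) a = ((c.perim x a : ℝ) : UnitAddCircle) := rfl

theorem diagonal_coe (c : SpinelessCactus n) (x : ℝ) (a : Fin n) :
    c.diagonal (x : UnitAddCircle) a = -((c.perim (-x) a : ℝ) : UnitAddCircle) := rfl

theorem diagonalHomotopy_one (c : SpinelessCactus n) : c.diagonalHomotopy 1 = c.diagonal := by
  funext θ a
  induction θ using QuotientAddGroup.induction_on with
  | H x =>
    refine (c.diagonalHomotopy_coe 1 x a).trans ((congrArg _ ?_).trans (c.diagonal_coe x a).symm)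
    simp

theorem diagonalHomotopy_zero (c : SpinelessCactus n) (θ : UnitAddCircle) (a : Fin n) :
    c.diagonalHomotopy 0 θ a = θ := by
  induction θ using QuotientAddGroup.induction_on with
  | H x =>
    refine (c.diagonalHomotopy_coe 0 x a).trans ?_
    rw [← AddCircle.coe_neg]
    congr 1
    ring

theorem diagonal_zero (c : SpinelessCactus n) : c.diagonal 0 = 0 := by
  funext a
  refine (c.diagonal_coe 0 a).trans ?_
  simp [c.perim_zero]

theorem continuous_diagonalHomotopy {Q : Type*} [TopologicalSpace Q] {t : Q → ℝ}
    {θ : Q → UnitAddCircle} {f : Q → SpinelessCactus n} (ht : Continuous t) (hθ : Continuous θ)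
    (hf : Continuous f) : Continuous fun q => (f q).diagonalHomotopy (t q) (θ q) := by
  refine continuous_pi fun a => ?_
  have h : Continuous fun q : UnitAddCircle × (ℝ × SpinelessCactus n) =>
      q.2.2.diagonalHomotopy q.2.1 q.1 a := by
    refine continuous_of_circle_prod ?_
    simp only [diagonalHomotopy_coe]
    have h₁ : Continuous fun z : ℝ × (ℝ × SpinelessCactus n) => z.2.2.perim (-z.1) a :=
      (continuous_apply a).comp (continuous_perim_eval.comp
        (continuous_snd.snd.prodMk continuous_fst.neg))
    refine ((AddCircle.continuous_mk' 1).comp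
      (?_ : Continuous fun z : ℝ × (ℝ × SpinelessCactus n) =>
        z.2.1 * z.2.2.perim (-z.1) a + (1 - z.2.1) * -z.1)).neg
    exact (continuous_snd.fst.mul h₁).add
      ((continuous_const.sub continuous_snd.fst).mul continuous_fst.neg)
  exact h.comp (hθ.prodMk (ht.prodMk hf))

/-! ### Cacti with one lobe -/

/-- With a single lobe, proportionality to arc length leaves no freedom. Consequently rotation acts
trivially and `Δ` is the identity, which is why inserting the unit perturbs nothing. -/
theorem perim_one (c : SpinelessCactus 1) (x : ℝ) (a : Fin 1) : c.perim x a = x := by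
  have h := c.arclength x
  simp only [Finset.univ_unique, Finset.sum_singleton] at h
  rw [Subsingleton.elim a default]
  exact mul_left_cancel₀ (c.radius_pos _).ne' h

theorem rotate_one (θ : UnitAddCircle) (c : SpinelessCactus 1) : c.rotate θ = c := by
  refine SpinelessCactus.ext (c.radius_rotate θ) ?_
  funext x a
  rw [perim_one, perim_one]

theorem diagonal_one (c : SpinelessCactus 1) (θ : UnitAddCircle) (a : Fin 1) :
    c.diagonal θ a = θ := by
  induction θ using QuotientAddGroup.induction_on with
  | H x =>
    refine (c.diagonal_coe x a).trans ?_
    rw [perim_one, AddCircle.coe_neg, neg_neg]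

/-! ### Contraction of the radii to one -/

/-- All radii are moved linearly to `1`. -/
noncomputable def shrink (c : SpinelessCactus n) (t : unitInterval) : SpinelessCactus n :=
  c.rescale (fun a => (1 - (t : ℝ)) * c.radius a + t) fun a => by
    have h₁ := c.radius_pos a
    have h₂ := t.2.1
    -- For `t < 1` the first summand is positive; at `t = 1` it vanishes and the radius is `1`.
    rcases t.2.2.lt_or_eq with h₃ | h₃
    · exact add_pos_of_pos_of_nonneg (mul_pos (by linarith) h₁) h₂
    · rw [h₃]; simp

theorem shrink_zero (c : SpinelessCactus n) : c.shrink 0 = c :=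
  rescale_eq_self _ _ _ (by simp)

theorem shrink_one (c : SpinelessCactus n) : c.shrink 1 = c.normalize.1 := by
  refine SamePath.eq ((rescale_samePath _ _ _).trans (samePath_rescale _ _ _)) ?_
  funext a
  simp [shrink, rescale, normalize]

theorem smul_shrink (σ : Equiv.Perm (Fin n)) (c : SpinelessCactus n) (t : unitInterval) :
    (σ • c).shrink t = σ • c.shrink t :=
  smul_rescale σ c _ _ _ _ rfl

theorem continuous_shrink {Q : Type*} [TopologicalSpace Q] {f : Q → SpinelessCactus n}
    {t : Q → unitInterval} (hf : Continuous f) (ht : Continuous t) :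
    Continuous fun q => (f q).shrink (t q) := by
  have h₁ : Continuous fun q => (t q : ℝ) := continuous_subtype_val.comp ht
  refine continuous_rescale hf (continuous_pi fun a => ?_) _
  exact ((continuous_const.sub h₁).mul
    ((continuous_apply a).comp (continuous_radius.comp hf))).add h₁

theorem normalize_val (c : NormalizedSpinelessCactus n) : c.1.normalize = c :=
  Subtype.ext (rescale_eq_self _ _ _ (funext fun a => (c.2 a).symm))

theorem smul_normalize (σ : Equiv.Perm (Fin n)) (c : SpinelessCactus n) :
    (σ • c).normalize = σ • c.normalize :=
  Subtype.ext (smul_rescale σ c _ _ _ _ rfl)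

theorem continuous_normalize : Continuous fun c : SpinelessCactus n => c.normalize :=
  NormalizedSpinelessCactus.continuous_iff_val.2
    (continuous_rescale continuous_id continuous_const _)

end SpinelessCactus

/-! ### Products of collections -/

section Products

variable {C D : SymCollection}

theorem isQuasiOperad_bicrossed
    (hC : ∀ (n : ℕ) (σ : Equiv.Perm (Fin n)), Continuous fun a : C.obj n => σ • a)
    (hD : ∀ (n : ℕ) (σ : Equiv.Perm (Fin n)), Continuous fun a : D.obj n => σ • a)
    {L : LeftTwist C D} {R : RightTwist C D} (hL : IsLeftTwist L) (hR : IsRightTwist R) :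
    IsQuasiOperad (C.prod D) (bicrossedComp L R) where
  continuous_act n σ := (hC n σ).prodMap (hD n σ)
  continuous_comp m n p h i := by
    have h₁ := (hL.continuous h i).comp (f := fun q : (C.obj m × D.obj m) × C.obj n × D.obj n =>
      (q.1.1, q.1.2, q.2.1)) (by fun_prop)
    have h₂ := (hR.continuous h i).comp (f := fun q : (C.obj m × D.obj m) × C.obj n × D.obj n =>
      (q.1.2, q.2.1, q.2.2)) (by fun_prop)
    exact h₁.prodMk h₂
  equivariant m n p h i σ τ a b :=
    Prod.ext (hL.equivariant h i σ τ a.1 a.2 b.1) (hR.equivariant h i σ τ a.2 b.1 b.2)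

/-- As quasi-operads need no associativity, any jointly continuous family of equivariant twists
gives a homotopy. Semi-direct products are included, as the case in which the right twist ignores
the cactus argument. -/
theorem homotopyEquivalent_bicrossed
    (hC : ∀ (n : ℕ) (σ : Equiv.Perm (Fin n)), Continuous fun a : C.obj n => σ • a)
    (hD : ∀ (n : ℕ) (σ : Equiv.Perm (Fin n)), Continuous fun a : D.obj n => σ • a)
    (L : unitInterval → LeftTwist C D) (R : unitInterval → RightTwist C D)
    (hL : ∀ ⦃m n p : ℕ⦄ (h : m + n = p + 1) (i : Fin m), Continuous
      fun q : unitInterval × C.obj m × D.obj m × C.obj n => L q.1 h i q.2.1 q.2.2.1 q.2.2.2)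
    (hR : ∀ ⦃m n p : ℕ⦄ (h : m + n = p + 1) (i : Fin m), Continuous
      fun q : unitInterval × D.obj m × C.obj n × D.obj n => R q.1 h i q.2.1 q.2.2.1 q.2.2.2)
    (hL' : ∀ t ⦃m n p : ℕ⦄ (h : m + n = p + 1) (i : Fin m) (σ : Equiv.Perm (Fin m))
      (τ : Equiv.Perm (Fin n)) (c : C.obj m) (d : D.obj m) (c' : C.obj n),
      L t h (σ i) (σ • c) (σ • d) (τ • c') = blockPerm h i σ τ • L t h i c d c')
    (hR' : ∀ t ⦃m n p : ℕ⦄ (h : m + n = p + 1) (i : Fin m) (σ : Equiv.Perm (Fin m))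
      (τ : Equiv.Perm (Fin n)) (d : D.obj m) (c' : C.obj n) (d' : D.obj n),
      R t h (σ i) (σ • d) (τ • c') (τ • d') = blockPerm h i σ τ • R t h i d c' d') :
    HomotopyEquivalent (bicrossedComp (L 0) (R 0)) (bicrossedComp (L 1) (R 1)) := by
  refine ⟨fun t => bicrossedComp (L t) (R t), rfl, rfl, fun t => ?_, fun m n p h i => ?_⟩
  · refine isQuasiOperad_bicrossed hC hD ⟨fun m n p h i => ?_, hL' t⟩ ⟨fun m n p h i => ?_, hR' t⟩
    · exact (hL h i).comp (continuous_const.prodMk continuous_id)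
    · exact (hR h i).comp (continuous_const.prodMk continuous_id)
  · have h₁ := (hL h i).comp
      (f := fun q : unitInterval × (C.obj m × D.obj m) × C.obj n × D.obj n =>
        (q.1, q.2.1.1, q.2.1.2, q.2.2.1)) (by fun_prop)
    have h₂ := (hR h i).comp
      (f := fun q : unitInterval × (C.obj m × D.obj m) × C.obj n × D.obj n =>
        (q.1, q.2.1.2, q.2.2.1, q.2.2.2)) (by fun_prop)
    exact h₁.prodMk h₂

end Products

/-! ### Continuity and equivariance of the twisted compositions -/

/-- The perturbation of the operad built on `S^1` by the deformed diagonals. -/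
noncomputable def circlesTwistHomotopy (t : ℝ) : RightTwist Cact Circles := fun _ n _ h i θ C' θ' =>
  splice h i θ (fun k : Fin n => SpinelessCactus.diagonalHomotopy C' t (θ i) k + θ' k)

theorem circlesTwistHomotopy_zero :
    circlesTwistHomotopy 0 = fun _ _ _ h i θ _ θ' => circlesComp h i θ θ' := by
  funext m n p h i θ C' θ'
  change splice h i _ _ = splice h i _ _
  congr 1
  funext k
  exact congrArg (· + θ' k) (SpinelessCactus.diagonalHomotopy_zero C' (θ i) k)

theorem circlesTwistHomotopy_one : circlesTwistHomotopy 1 = circlesTwist := by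
  funext m n p h i θ C' θ'
  change splice h i _ _ = splice h i _ _
  congr 1
  funext k
  exact congrArg (fun f => f (θ i) k + θ' k) (SpinelessCactus.diagonalHomotopy_one C')

theorem continuous_circlesTwistHomotopy {m n p : ℕ} (h : m + n = p + 1) (i : Fin m) {Q : Type*}
    [TopologicalSpace Q] {t : Q → ℝ} {θ : Q → Fin m → UnitAddCircle} {f : Q → SpinelessCactus n}
    {θ' : Q → Fin n → UnitAddCircle} (ht : Continuous t) (hθ : Continuous θ) (hf : Continuous f)
    (hθ' : Continuous θ') :
    Continuous fun q => circlesTwistHomotopy (t q) h i (θ q) (f q) (θ' q) := by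
  refine continuous_splice h i hθ ?_
  exact (SpinelessCactus.continuous_diagonalHomotopy ht ((continuous_apply i).comp hθ) hf).add hθ'

theorem circlesTwistHomotopy_smul (t : ℝ) {m n p : ℕ} (h : m + n = p + 1) (i : Fin m)
    (σ : Equiv.Perm (Fin m)) (τ : Equiv.Perm (Fin n)) (θ : Circles.obj m) (C' : Cact.obj n)
    (θ' : Circles.obj n) :
    circlesTwistHomotopy t h (σ i) (σ • θ) (τ • C') (τ • θ') =
      blockPerm h i σ τ • circlesTwistHomotopy t h i θ C' θ' := by
  have key : ∀ (θ : Fin m → UnitAddCircle) (θ' : Fin n → UnitAddCircle) (C' : SpinelessCactus n),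
      splice h (σ i) (fun j => θ (σ⁻¹ j))
        (fun k => C'.diagonalHomotopy t (θ (σ⁻¹ (σ i))) (τ⁻¹ k) + θ' (τ⁻¹ k)) =
      fun q => splice h i θ (fun k => C'.diagonalHomotopy t (θ i) k + θ' k)
        ((blockPerm h i σ τ)⁻¹ q) := by
    intro θ θ' C'
    rw [← Equiv.Perm.mul_apply, inv_mul_cancel, Equiv.Perm.one_apply]
    exact splice_perm h i σ τ θ (fun k => C'.diagonalHomotopy t (θ i) k + θ' k)
  exact key θ θ' C'

theorem circles_smul_apply {m : ℕ} (σ : Equiv.Perm (Fin m)) (θ : Circles.obj m) (i : Fin m) :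
    (σ • θ) (σ i) = θ i := by
  change θ (σ⁻¹ (σ i)) = θ i
  rw [← Equiv.Perm.mul_apply, inv_mul_cancel, Equiv.Perm.one_apply]

theorem SpinelessCactus.smul_glue_rotate {m n p : ℕ} (h : m + n = p + 1) (i : Fin m)
    (σ : Equiv.Perm (Fin m)) (τ : Equiv.Perm (Fin n)) (θ : UnitAddCircle) (c : SpinelessCactus m)
    (c' : SpinelessCactus n) : (σ • c).glue h (σ i) ((τ • c').rotate θ) =
      blockPerm h i σ τ • c.glue h i (c'.rotate θ) := by
  rw [smul_rotate, smul_glue]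

theorem isLeftTwist_cactTwist : IsLeftTwist cactTwist where
  continuous m n p h i := by
    have h₁ : Continuous fun q : Cact.obj m × (Fin m → UnitAddCircle) × Cact.obj n => q.2.1 i :=
      by fun_prop
    exact SpinelessCactus.continuous_glue h i continuous_fst
      (SpinelessCactus.continuous_rotate h₁ continuous_snd.snd)
  equivariant m n p h i σ τ c d c' := by
    change SpinelessCactus.glue h (σ i) (σ • c) (SpinelessCactus.rotate ((σ • d) (σ i)) (τ • c')) =
      blockPerm h i σ τ • SpinelessCactus.glue h i c (SpinelessCactus.rotate (d i) c')
    rw [circles_smul_apply]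
    exact SpinelessCactus.smul_glue_rotate h i σ τ (d i) c c'

theorem NormalizedSpinelessCactus.continuous_rotate {n : ℕ} {Q : Type*} [TopologicalSpace Q]
    {θ : Q → UnitAddCircle} {f : Q → NormalizedSpinelessCactus n} (hθ : Continuous θ)
    (hf : Continuous f) : Continuous fun q => (f q).rotate (θ q) :=
  continuous_iff_val.2 (SpinelessCactus.continuous_rotate hθ (continuous_iff_val.1 hf))

theorem NormalizedSpinelessCactus.smul_rotate {n : ℕ} (σ : Equiv.Perm (Fin n)) (θ : UnitAddCircle)
    (c : NormalizedSpinelessCactus n) : (σ • c).rotate θ = σ • c.rotate θ :=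
  Subtype.ext (SpinelessCactus.smul_rotate σ θ c.1)

theorem NormalizedSpinelessCactus.smul_glue_rotate {m n p : ℕ} (h : m + n = p + 1) (i : Fin m)
    (σ : Equiv.Perm (Fin m)) (τ : Equiv.Perm (Fin n)) (θ : UnitAddCircle) (c : NormalizedSpinelessCactus m)
    (c' : NormalizedSpinelessCactus n) : (σ • c).glue h (σ i) ((τ • c').rotate θ) =
      blockPerm h i σ τ • c.glue h i (c'.rotate θ) := by
  rw [smul_rotate, smul_glue]

theorem isLeftTwist_ncactTwist : IsLeftTwist ncactTwist where
  continuous m n p h i := by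
    have h₁ : Continuous fun q : NCact.obj m × (Fin m → UnitAddCircle) × NCact.obj n => q.2.1 i :=
      by fun_prop
    exact NormalizedSpinelessCactus.continuous_glue h i continuous_fst
      (NormalizedSpinelessCactus.continuous_rotate h₁ continuous_snd.snd)
  equivariant m n p h i σ τ c d c' := by
    change NormalizedSpinelessCactus.glue h (σ i) (σ • c)
        (NormalizedSpinelessCactus.rotate ((σ • d) (σ i)) (τ • c')) =
      blockPerm h i σ τ •
        NormalizedSpinelessCactus.glue h i c (NormalizedSpinelessCactus.rotate (d i) c')
    rw [circles_smul_apply]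
    exact NormalizedSpinelessCactus.smul_glue_rotate h i σ τ (d i) c c'

/-- The twist by `Δ` is the end at time `1` of the deformation, from which continuity and
equivariance are inherited. -/
theorem isRightTwist_circlesTwist : IsRightTwist circlesTwist where
  continuous m n p h i := by
    rw [← circlesTwistHomotopy_one]
    exact continuous_circlesTwistHomotopy h i continuous_const continuous_fst
      continuous_snd.fst continuous_snd.snd
  equivariant m n p h i σ τ d c' d' := by
    rw [← circlesTwistHomotopy_one]
    exact circlesTwistHomotopy_smul 1 h i σ τ d c' d'

theorem isRightTwist_ncirclesTwist : IsRightTwist ncirclesTwist where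
  continuous _ _ _ h i :=
    (isRightTwist_circlesTwist.continuous h i).comp (continuous_fst.prodMk
      ((NormalizedSpinelessCactus.continuous_val.comp continuous_snd.fst).prodMk
        continuous_snd.snd))
  equivariant _ _ _ h i σ τ d c' d' :=
    isRightTwist_circlesTwist.equivariant h i σ τ d c'.1 d'

/-! ### Units -/

/-- Composing a unit with itself gives `e + e = e` in the circle. -/
theorem circles_unit_apply {e : Circles.obj 1} (he : IsOperadUnit circlesComp e) (i : Fin 1) :
    e i = (0 : UnitAddCircle) := by
  have key : ∀ e : Fin 1 → UnitAddCircle,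
      splice rfl 0 e (fun k => e 0 + e k) = e → e i = 0 := by
    intro e he
    have h := congrFun he i
    rw [splice_apply_of_eq _ 0 i _ _ i (by simp), Subsingleton.elim (0 : Fin 1) i] at h
    simpa using h
  exact key e ((he 1 e).1 0)

/-- Isolates the four places where a unit enters a twisted composition; if none of them is
perturbed, the unit laws hold factor by factor. -/
theorem isOperadUnit_bicrossed {C : SymCollection} {γ : Compositions C}
    {L : LeftTwist C Circles} {R : RightTwist C Circles} {eC : C.obj 1} {eD : Circles.obj 1}
    (hC : IsOperadUnit γ eC) (hD : IsOperadUnit circlesComp eD)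
    (h₁ : ∀ (m : ℕ) (i : Fin m) (c : C.obj m) (d : Circles.obj m),
      L rfl i c d eC = γ rfl i c eC)
    (h₂ : ∀ ⦃n p : ℕ⦄ (h : 1 + n = p + 1) (i : Fin 1) (c : C.obj 1) (c' : C.obj n),
      L h i c eD c' = γ h i c c')
    (h₃ : ∀ ⦃m p : ℕ⦄ (h : m + 1 = p + 1) (i : Fin m) (d : Circles.obj m) (d' : Circles.obj 1),
      R h i d eC d' = circlesComp h i d d')
    (h₄ : ∀ ⦃n p : ℕ⦄ (h : 1 + n = p + 1) (i : Fin 1) (c' : C.obj n) (d' : Circles.obj n),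
      R h i eD c' d' = circlesComp h i eD d') :
    IsOperadUnit (bicrossedComp L R) (eC, eD) := fun n a =>
  ⟨fun i => Prod.ext ((h₁ n i a.1 a.2).trans ((hC n a.1).1 i))
      ((h₃ rfl i a.2 eD).trans ((hD n a.2).1 i)),
    Prod.ext ((h₂ _ 0 eC a.1).trans (hC n a.1).2) ((h₄ _ 0 a.1 a.2).trans (hD n a.2).2)⟩

theorem cactTwist_unit_right {m p : ℕ} (h : m + 1 = p + 1) (i : Fin m) (c : Cact.obj m)
    (d : Circles.obj m) (e : Cact.obj 1) : cactTwist h i c d e = cactComp h i c e :=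
  congrArg (SpinelessCactus.glue h i c) (SpinelessCactus.rotate_one (d i) e)

theorem cactTwist_unit_left {n p : ℕ} (h : 1 + n = p + 1) (i : Fin 1) (c : Cact.obj 1)
    {e : Circles.obj 1} (he : IsOperadUnit circlesComp e) (c' : Cact.obj n) :
    cactTwist h i c e c' = cactComp h i c c' := by
  refine congrArg (SpinelessCactus.glue h i c) ?_
  rw [circles_unit_apply he]
  exact SpinelessCactus.rotate_zero c'

theorem ncactTwist_unit_right {m p : ℕ} (h : m + 1 = p + 1) (i : Fin m) (c : NCact.obj m)
    (d : Circles.obj m) (e : NCact.obj 1) : ncactTwist h i c d e = ncactComp h i c e :=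
  congrArg (NormalizedSpinelessCactus.glue h i c)
    (Subtype.ext (SpinelessCactus.rotate_one (d i) (Subtype.val e)))

theorem ncactTwist_unit_left {n p : ℕ} (h : 1 + n = p + 1) (i : Fin 1) (c : NCact.obj 1)
    {e : Circles.obj 1} (he : IsOperadUnit circlesComp e) (c' : NCact.obj n) :
    ncactTwist h i c e c' = ncactComp h i c c' := by
  refine congrArg (NormalizedSpinelessCactus.glue h i c) (Subtype.ext ?_)
  rw [circles_unit_apply he]
  exact SpinelessCactus.rotate_zero (Subtype.val c')

theorem circlesTwist_unit_right {m p : ℕ} (h : m + 1 = p + 1) (i : Fin m) (d : Circles.obj m)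
    (e : Cact.obj 1) (d' : Circles.obj 1) : circlesTwist h i d e d' = circlesComp h i d d' :=
  congrArg (splice h i d) (funext fun k =>
    congrArg (· + d' k) (SpinelessCactus.diagonal_one e (d i) k))

theorem circlesTwist_unit_left {n p : ℕ} (h : 1 + n = p + 1) (i : Fin 1) {e : Circles.obj 1}
    (he : IsOperadUnit circlesComp e) (c' : Cact.obj n) (d' : Circles.obj n) :
    circlesTwist h i e c' d' = circlesComp h i e d' := by
  refine congrArg (splice h i e) (funext fun k => congrArg (· + d' k) ?_)
  rw [circles_unit_apply he]
  exact congrFun (SpinelessCactus.diagonal_zero c') k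

theorem isBicrossedDatum_cact : IsBicrossedDatum cactComp circlesComp cactTwist circlesTwist where
  left := isLeftTwist_cactTwist
  right := isRightTwist_circlesTwist
  unital eC _ hC hD :=
    ⟨isOperadUnit_bicrossed hC hD (fun _ i c d => cactTwist_unit_right rfl i c d eC)
      (fun _ _ h i c => cactTwist_unit_left h i c hD)
      (fun _ _ h i d => circlesTwist_unit_right h i d eC)
      (fun _ _ h i => circlesTwist_unit_left h i hD),
    fun _ _ h i c => cactTwist_unit_left h i c hD,
    fun _ _ h i d => circlesTwist_unit_right h i d eC⟩

theorem isSemidirectDatum_cact : IsSemidirectDatum cactComp circlesComp cactTwist where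
  left := isLeftTwist_cactTwist
  unital eC _ hC hD :=
    -- The semi-direct product is by definition the bi-crossed product with this right twist, which
    -- does not use the cactus.
    ⟨isOperadUnit_bicrossed (R := fun _ _ _ h i d _ d' => circlesComp h i d d') hC hD
      (fun _ i c d => cactTwist_unit_right rfl i c d eC)
      (fun _ _ h i c => cactTwist_unit_left h i c hD)
      (fun _ _ _ _ _ _ => rfl) (fun _ _ _ _ _ _ => rfl),
    fun _ _ h i c => cactTwist_unit_left h i c hD⟩

theorem isBicrossedDatum_ncact :
    IsBicrossedDatum ncactComp circlesComp ncactTwist ncirclesTwist where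
  left := isLeftTwist_ncactTwist
  right := isRightTwist_ncirclesTwist
  unital eC _ hC hD :=
    ⟨isOperadUnit_bicrossed hC hD (fun _ i c d => ncactTwist_unit_right rfl i c d eC)
      (fun _ _ h i c => ncactTwist_unit_left h i c hD)
      (fun _ _ h i d => circlesTwist_unit_right h i d eC.1)
      (fun _ _ h i c' => circlesTwist_unit_left h i hD c'.1),
    fun _ _ h i c => ncactTwist_unit_left h i c hD,
    fun _ _ h i d => circlesTwist_unit_right h i d eC.1⟩

theorem isSemidirectDatum_ncact : IsSemidirectDatum ncactComp circlesComp ncactTwist where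
  left := isLeftTwist_ncactTwist
  unital eC _ hC hD :=
    ⟨isOperadUnit_bicrossed (R := fun _ _ _ h i d _ d' => circlesComp h i d d') hC hD
      (fun _ i c d => ncactTwist_unit_right rfl i c d eC)
      (fun _ _ h i c => ncactTwist_unit_left h i c hD)
      (fun _ _ _ _ _ _ => rfl) (fun _ _ _ _ _ _ => rfl),
    fun _ _ h i c => ncactTwist_unit_left h i c hD⟩

/-! ### Homotopies of compositions -/

theorem isOperad_circles : IsOperad Circles circlesComp := isOperad_monoid UnitAddCircle

theorem continuous_symm_val {Y : Type*} [TopologicalSpace Y] :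
    Continuous fun q : unitInterval × Y => ((unitInterval.symm q.1 : unitInterval) : ℝ) :=
  continuous_subtype_val.comp (unitInterval.continuous_symm.comp continuous_fst)

theorem homotopyEquivalent_cact : HomotopyEquivalent (bicrossedComp cactTwist circlesTwist)
    (semidirectComp circlesComp cactTwist) := by
  have h := homotopyEquivalent_bicrossed isOperad_cact.continuous_act
    isOperad_circles.continuous_act (fun _ => cactTwist)
    -- Time is reversed: the true `Δ` sits at parameter `1` of the deformation and has to come
    -- first.
    (fun t => circlesTwistHomotopy (unitInterval.symm t : unitInterval))
    (fun _ _ _ h i => (isLeftTwist_cactTwist.continuous h i).comp continuous_snd)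
    (fun _ _ _ h i => continuous_circlesTwistHomotopy h i continuous_symm_val continuous_snd.fst
      continuous_snd.snd.fst continuous_snd.snd.snd)
    (fun _ => isLeftTwist_cactTwist.equivariant)
    (fun t _ _ _ h i σ τ => circlesTwistHomotopy_smul _ h i σ τ)
  simp only [unitInterval.symm_zero, unitInterval.symm_one, Set.Icc.coe_one, Set.Icc.coe_zero,
    circlesTwistHomotopy_one, circlesTwistHomotopy_zero] at h
  exact h

/-- The restriction of the perturbation by the deformed diagonals to normalized spineless cacti. -/
noncomputable def ncirclesTwistHomotopy (t : ℝ) : RightTwist NCact Circles :=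
  fun _ _ _ h i θ C' θ' => circlesTwistHomotopy t h i θ C'.1 θ'

theorem ncirclesTwistHomotopy_zero :
    ncirclesTwistHomotopy 0 = fun _ _ _ h i θ _ θ' => circlesComp h i θ θ' := by
  unfold ncirclesTwistHomotopy
  rw [circlesTwistHomotopy_zero]

theorem ncirclesTwistHomotopy_one : ncirclesTwistHomotopy 1 = ncirclesTwist := by
  unfold ncirclesTwistHomotopy
  rw [circlesTwistHomotopy_one]
  rfl

theorem homotopyEquivalent_ncact : HomotopyEquivalent (bicrossedComp ncactTwist ncirclesTwist)
    (semidirectComp circlesComp ncactTwist) := by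
  have h := homotopyEquivalent_bicrossed isQuasiOperad_ncact.continuous_act
    isOperad_circles.continuous_act (fun _ => ncactTwist)
    (fun t => ncirclesTwistHomotopy (unitInterval.symm t : unitInterval))
    (fun _ _ _ h i => (isLeftTwist_ncactTwist.continuous h i).comp continuous_snd)
    (fun _ _ _ h i => continuous_circlesTwistHomotopy h i continuous_symm_val continuous_snd.fst
      (NormalizedSpinelessCactus.continuous_val.comp continuous_snd.snd.fst)
      continuous_snd.snd.snd)
    (fun _ => isLeftTwist_ncactTwist.equivariant)
    (fun t _ _ _ h i σ τ θ C' => circlesTwistHomotopy_smul _ h i σ τ θ C'.1)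
  simp only [unitInterval.symm_zero, unitInterval.symm_one, Set.Icc.coe_one, Set.Icc.coe_zero,
    ncirclesTwistHomotopy_one, ncirclesTwistHomotopy_zero] at h
  exact h

/-! ### Compositions which only depend on the normalizations -/

namespace SpinelessCactus

/-- The twisted gluing of `c'` into `c` after the radii of `c'` have been moved towards `1`, with
the radii that the lobes would have had without this. -/
noncomputable def shrinkGlue {m n p : ℕ} (t : unitInterval) (h : m + n = p + 1) (i : Fin m)
    (c : SpinelessCactus m) (θ : UnitAddCircle) (c' : SpinelessCactus n) : SpinelessCactus p :=
  (c.glue h i ((c'.shrink t).rotate θ)).rescale (c.glue h i c').radius (c.glue h i c').radius_pos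

variable {m n p : ℕ} (h : m + n = p + 1) (i : Fin m)

theorem shrinkGlue_zero (c : SpinelessCactus m) (θ : UnitAddCircle) (c' : SpinelessCactus n) :
    shrinkGlue 0 h i c θ c' = c.glue h i (c'.rotate θ) := by
  unfold shrinkGlue
  rw [shrink_zero]
  -- Rotation does not change radii, so the radii to be restored are already there.
  exact rescale_eq_self _ _ _ (by rw [glue_radius, glue_radius, radius_rotate])

theorem smul_shrinkGlue (t : unitInterval) (σ : Equiv.Perm (Fin m)) (τ : Equiv.Perm (Fin n))
    (c : SpinelessCactus m) (θ : UnitAddCircle) (c' : SpinelessCactus n) :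
    shrinkGlue t h (σ i) (σ • c) θ (τ • c') = blockPerm h i σ τ • shrinkGlue t h i c θ c' := by
  unfold shrinkGlue
  simp only [smul_shrink, smul_glue_rotate]
  exact smul_rescale _ _ _ _ _ _ (by rw [smul_glue, smul_radius])

theorem continuous_shrinkGlue {Q : Type*} [TopologicalSpace Q] {t : Q → unitInterval}
    {f : Q → SpinelessCactus m} {θ : Q → UnitAddCircle} {g : Q → SpinelessCactus n}
    (ht : Continuous t) (hf : Continuous f) (hθ : Continuous θ) (hg : Continuous g) :
    Continuous fun q => shrinkGlue (t q) h i (f q) (θ q) (g q) :=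
  continuous_rescale (continuous_glue h i hf (continuous_rotate hθ (continuous_shrink hg ht)))
    (continuous_radius.comp (continuous_glue h i hf hg)) _

/-- The reason for shrinking: both sides have radii one, so only the paths matter. The inner cactus
is the same normalized one on both sides, and the radii of the outer cactus affect only the
parametrization, which `SamePath.glue` ignores. -/
theorem normalize_shrinkGlue_one (c : SpinelessCactus m) (θ : UnitAddCircle)
    (c' : SpinelessCactus n) : (shrinkGlue 1 h i c θ c').normalize =
      c.normalize.glue h i (c'.normalize.rotate θ) := by
  refine Subtype.ext (SamePath.eq ?_ (funext fun a =>
    (normalize _).2 a |>.trans ((NormalizedSpinelessCactus.glue h i c.normalize _).2 a).symm))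
  refine (rescale_samePath _ _ _).trans ((rescale_samePath _ _ _).trans ?_)
  rw [shrink_one]
  exact SamePath.glue h i ((samePath_rescale _ _ _).trans (samePath_rescale _ _ _)) _

end SpinelessCactus

/-- The twisted gluing after shrinking. -/
noncomputable def shrinkTwist (t : unitInterval) : LeftTwist Cact Circles :=
  fun _ _ _ h i c θ c' => SpinelessCactus.shrinkGlue t h i c (θ i) c'

/-- The perturbation of the operad built on `S^1` by the deformed diagonals of the shrunk cacti. -/
noncomputable def circlesShrinkTwist (t : unitInterval) : RightTwist Cact Circles :=
  fun _ _ _ h i θ c' θ' => circlesTwistHomotopy t h i θ (SpinelessCactus.shrink c' t) θ'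

/-- One parameter drives both deformations, the shrinking of the inner radii and the passage from
the plain diagonal to `Δ`. At time `0` neither has started, which gives the semi-direct product. -/
theorem homotopyEquivalent_shrink : HomotopyEquivalent (semidirectComp circlesComp cactTwist)
    (bicrossedComp (shrinkTwist 1) (circlesShrinkTwist 1)) := by
  have h := homotopyEquivalent_bicrossed isOperad_cact.continuous_act
    isOperad_circles.continuous_act shrinkTwist circlesShrinkTwist
    (fun m n p h i => by
      have h₁ : Continuous fun q : unitInterval × Cact.obj m × (Fin m → UnitAddCircle) ×
        Cact.obj n => q.2.2.1 i := by fun_prop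
      exact SpinelessCactus.continuous_shrinkGlue h i continuous_fst continuous_snd.fst h₁
        continuous_snd.snd.snd)
    (fun _ _ _ h i => continuous_circlesTwistHomotopy h i
      (continuous_subtype_val.comp continuous_fst) continuous_snd.fst
      (SpinelessCactus.continuous_shrink continuous_snd.snd.fst continuous_fst)
      continuous_snd.snd.snd)
    (fun t m n p h i σ τ c d c' => by
      change SpinelessCactus.shrinkGlue t h (σ i) (σ • c) ((σ • d) (σ i)) (τ • c') =
        blockPerm h i σ τ • SpinelessCactus.shrinkGlue t h i c (d i) c'
      rw [circles_smul_apply]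
      exact SpinelessCactus.smul_shrinkGlue h i t σ τ c (d i) c')
    (fun t m n p h i σ τ d c' d' =>
      (congrArg (fun x => circlesTwistHomotopy t h (σ i) (σ • d) x (τ • d'))
        (SpinelessCactus.smul_shrink τ c' t)).trans
        (circlesTwistHomotopy_smul t h i σ τ d (SpinelessCactus.shrink c' t) d'))
  have hL : shrinkTwist 0 = cactTwist := by
    funext m n p h i c θ c'
    exact SpinelessCactus.shrinkGlue_zero h i c (θ i) c'
  have hR : circlesShrinkTwist 0 = fun _ _ _ h i θ _ θ' => circlesComp h i θ θ' := by
    unfold circlesShrinkTwist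
    rw [Set.Icc.coe_zero, circlesTwistHomotopy_zero]
  rw [hL, hR] at h
  exact h

/-- Normalization is the morphism, the inclusion of normalized cacti its homotopy inverse; the
circle coordinates are left alone throughout. -/
theorem hasEquivalence_shrink : HasEquivalence
    (bicrossedComp (shrinkTwist 1) (circlesShrinkTwist 1))
    (bicrossedComp ncactTwist ncirclesTwist) := by
  let f : ∀ n, C(SpinelessCactus n × (Fin n → UnitAddCircle),
      NormalizedSpinelessCactus n × (Fin n → UnitAddCircle)) := fun n =>
    ⟨Prod.map SpinelessCactus.normalize id,
      SpinelessCactus.continuous_normalize.prodMap continuous_id⟩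
  let g : ∀ n, C(NormalizedSpinelessCactus n × (Fin n → UnitAddCircle),
      SpinelessCactus n × (Fin n → UnitAddCircle)) := fun n =>
    ⟨Prod.map Subtype.val id, NormalizedSpinelessCactus.continuous_val.prodMap continuous_id⟩
  -- Shrinking run backwards, from the normalized cactus to the given one.
  let H : ∀ n, ContinuousMap.Homotopy ((g n).comp (f n)) (ContinuousMap.id _) := fun n =>
    { toFun := fun q => (q.2.1.shrink (unitInterval.symm q.1), q.2.2)
      continuous_toFun := (SpinelessCactus.continuous_shrink continuous_snd.fst
        (unitInterval.continuous_symm.comp continuous_fst)).prodMk continuous_snd.snd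
      map_zero_left := fun q => by
        rw [unitInterval.symm_zero]
        exact Prod.ext (SpinelessCactus.shrink_one q.1) rfl
      map_one_left := fun q => by
        rw [unitInterval.symm_one]
        exact Prod.ext (SpinelessCactus.shrink_zero q.1) rfl }
  -- A normalized cactus equals its normalization, so the homotopy on this side is constant.
  have hfg : ∀ n, (f n).comp (g n) = ContinuousMap.id _ := fun n =>
    ContinuousMap.ext fun q => Prod.ext (SpinelessCactus.normalize_val q.1) rfl
  let K : ∀ n, ContinuousMap.Homotopy ((f n).comp (g n)) (ContinuousMap.id _) := fun n =>
    { toFun := fun q => q.2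
      continuous_toFun := continuous_snd
      map_zero_left := fun q => (congrArg (fun k => k q) (hfg n)).symm
      map_one_left := fun _ => rfl }
  refine ⟨f, fun n σ a => Prod.ext (SpinelessCactus.smul_normalize σ a.1) rfl,
    fun m n p h i a b => Prod.ext
      (SpinelessCactus.normalize_shrinkGlue_one h i a.1 (a.2 i) b.1) ?_,
    fun n => ⟨g n, fun _ _ => rfl, ⟨H n, fun t σ a =>
      Prod.ext (SpinelessCactus.smul_shrink σ a.1 _) rfl⟩, ⟨K n, fun _ _ _ => rfl⟩⟩⟩
  change circlesTwistHomotopy (1 : unitInterval) h i a.2 (SpinelessCactus.shrink b.1 1) b.2 =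
    circlesTwist h i a.2 (SpinelessCactus.normalize b.1).1 b.2
  rw [Set.Icc.coe_one, circlesTwistHomotopy_one]
  exact congrArg (fun x => circlesTwist h i a.2 x b.2) (SpinelessCactus.shrink_one b.1)

/-! ### Cacti with spines: transport of structure and separation of the local zeros -/

theorem QuasiOperadIso.isQuasiOperad {O P : SymCollection} {γ : Compositions O}
    {δ : Compositions P} (Φ : QuasiOperadIso γ δ) (h : IsQuasiOperad P δ) :
    IsQuasiOperad O γ where
  continuous_act n σ := by
    rw [← (Φ.homeo n).comp_continuous_iff]
    have : (Φ.homeo n ∘ fun a => σ • a) = (fun b => σ • b) ∘ Φ.homeo n := funext (Φ.map_act n σ)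
    rw [this]
    exact (h.continuous_act n σ).comp (Φ.homeo n).continuous
  continuous_comp m n p hmn i := by
    rw [← (Φ.homeo p).comp_continuous_iff]
    have : (Φ.homeo p ∘ fun q : O.obj m × O.obj n => γ hmn i q.1 q.2) =
        (fun q : P.obj m × P.obj n => δ hmn i q.1 q.2) ∘ Prod.map (Φ.homeo m) (Φ.homeo n) :=
      funext fun q => Φ.map_comp hmn i q.1 q.2
    rw [this]
    exact (h.continuous_comp hmn i).comp ((Φ.homeo m).continuous.prodMap (Φ.homeo n).continuous)
  equivariant m n p hmn i σ τ a b := by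
    refine (Φ.homeo p).injective ?_
    simp only [Φ.map_comp, Φ.map_act]
    exact h.equivariant hmn i σ τ _ _

namespace SpinelessCactus

variable {n : ℕ}

theorem outer_zero (c : SpinelessCactus n) (a : Fin n) : c.outer 0 a = 0 :=
  (c.outer_coe 0 a).trans (by rw [c.perim_zero]; rfl)

/-- The perimeter is the unique lift of the map to the product of the lobes. -/
theorem perim_eq_of_outer_eq {c c' : SpinelessCactus n} (h : ∀ x a, c.outer x a = c'.outer x a) :
    c.perim = c'.perim := by
  funext x a
  have h₁ : ∀ y, ∃ k : ℤ, (k : ℝ) = c.perim y a - c'.perim y a := by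
    intro y
    have := h (y : UnitAddCircle) a
    rw [outer_coe, outer_coe, ← sub_eq_zero, ← AddCircle.coe_sub, AddCircle.coe_eq_zero_iff] at this
    obtain ⟨k, hk⟩ := this
    exact ⟨k, by simpa using hk⟩
  choose k hk using h₁
  -- The difference of the two lifts is continuous and integer valued, hence constant, and it
  -- vanishes at `0`.
  have hc : Continuous k := by
    rw [Int.isClosedEmbedding_coe_real.isInducing.continuous_iff]
    convert (c.continuous_perim a).sub (c'.continuous_perim a) using 1
    exact funext hk
  have h₂ := PreconnectedSpace.constant inferInstance hc (x := x) (y := 0)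
  have h₃ := hk x
  have h₄ := hk 0
  rw [c.perim_zero, c'.perim_zero] at h₄
  rw [h₂, h₄] at h₃
  linarith

end SpinelessCactus

namespace Cactus

variable {n : ℕ}

/-- At the global zero the spineless perimeter vanishes, so the value there is `-z`; after removing
`z`, unique lifting determines the spineless cactus. -/
theorem ofSpineless_inj {C C' : SpinelessCactus n} {z z' : Fin n → UnitAddCircle}
    (h : ofSpineless C z = ofSpineless C' z') : C = C' ∧ z = z' := by
  have h₁ : ∀ x a, C.outer x a - z a = C'.outer x a - z' a := fun x a =>
    congrFun (congrFun (congrArg Cactus.perim h) x) a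
  have hz : z = z' := by
    funext a
    have := h₁ 0 a
    rwa [C.outer_zero, C'.outer_zero, sub_right_inj] at this
  subst hz
  exact ⟨SpinelessCactus.ext (congrArg Cactus.radius h)
    (SpinelessCactus.perim_eq_of_outer_eq fun x a => sub_left_injective (h₁ x a)), rfl⟩

theorem ofSpineless_bijective : Function.Bijective
    fun q : SpinelessCactus n × (Fin n → UnitAddCircle) => ofSpineless q.1 q.2 := by
  refine ⟨fun q q' h => Prod.ext (ofSpineless_inj h).1 (ofSpineless_inj h).2, fun c => ?_⟩
  obtain ⟨C, z, hr, hz⟩ := c.exists_zeros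
  exact ⟨(C, z), Cactus.ext hr (funext fun x => funext fun a => (hz x a).symm)⟩

/-- A cactus is a spineless cactus together with the coordinates of the local zeros. -/
noncomputable def homeo (n : ℕ) :
    SpinelessCactus n × (Fin n → UnitAddCircle) ≃ₜ Cactus n :=
  -- The topology of cacti is coinduced along this bijection, so open sets correspond by definition.
  (Equiv.ofBijective _ ofSpineless_bijective).toHomeomorph fun _ => isOpen_coinduced.symm

theorem ofSpineless_smul (σ : Equiv.Perm (Fin n)) (C : SpinelessCactus n)
    (z : Fin n → UnitAddCircle) :
    ofSpineless (σ • C) (fun b => z (σ⁻¹ b)) = σ • ofSpineless C z := by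
  refine Cactus.ext rfl (funext fun x => funext fun a => ?_)
  induction x using QuotientAddGroup.induction_on with
  | H t => rfl

/-- The origin of both twists. With `s` a lift of `z i` and `y` the angle reached on the `i`-th
lobe, the inner perimeter is read at `y - s`. Subtracting its value at `-s` gives the perimeter of
the rotated cactus, and this constant is compensated by `Δ` in the new coordinates of the zeros. -/
theorem ofSpineless_glue {m p : ℕ} (h : m + n = p + 1) (i : Fin m) (C : SpinelessCactus m)
    (z : Fin m → UnitAddCircle) (C' : SpinelessCactus n) (z' : Fin n → UnitAddCircle) :
    (ofSpineless C z).glue h i (ofSpineless C' z') =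
      ofSpineless (C.glue h i (C'.rotate (z i)))
        (splice h i z (fun k => C'.diagonal (z i) k + z' k)) := by
  refine Cactus.ext ?_ (funext fun x => ?_)
  · change splice h i C.radius (fun k => C.radius i / (∑ l, C'.radius l) * C'.radius k) =
      (C.glue h i (C'.rotate (z i))).radius
    rw [SpinelessCactus.glue_radius, SpinelessCactus.radius_rotate]
  · change splice h i (fun a => C.outer x a - z a)
        (fun k => C'.outer (C.outer x i - z i) k - z' k) =
      fun a => (C.glue h i (C'.rotate (z i))).outer x a -
        splice h i z (fun k => C'.diagonal (z i) k + z' k) a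
    induction x using QuotientAddGroup.induction_on with
    | H t =>
    obtain ⟨s, hs⟩ := QuotientAddGroup.mk_surjective (z i)
    funext a
    revert a
    refine forall_slot h i (fun j => ?_) (fun k => ?_)
    · simp only [splice_inl]
      congr 1
      change ((C.perim t j : ℝ) : UnitAddCircle) = (((C.glue h i _).perim t _ : ℝ) : UnitAddCircle)
      rw [SpinelessCactus.glue_perim, splice_inl]
    · simp only [splice_inr, ← hs]
      change (((C'.perim (C.perim t i - s) k : ℝ)) : UnitAddCircle) - z' k =
        (((C.glue h i (C'.rotateBy s)).perim t _ : ℝ) : UnitAddCircle) -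
          (-((C'.perim (-s) k : ℝ) : UnitAddCircle) + z' k)
      simp only [SpinelessCactus.glue_perim, splice_inr, SpinelessCactus.rotateBy,
        AddCircle.coe_sub]
      abel

/-- Rescaling a cactus with spines involves a choice of spineless cactus and zeros; injectivity of
`ofSpineless` shows that the choice is forced. -/
theorem ofSpineless_rescale (C : SpinelessCactus n) (z : Fin n → UnitAddCircle) (s : Fin n → ℝ)
    (hs : ∀ a, 0 < s a) : (ofSpineless C z).rescale s hs = ofSpineless (C.rescale s hs) z := by
  have h := (ofSpineless C z).exists_zeros.choose_spec.choose_spec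
  have h' := ofSpineless_inj (Cactus.ext h.1.symm (funext fun x => funext fun a => h.2 x a) :
    ofSpineless C z = ofSpineless _ (ofSpineless C z).exists_zeros.choose_spec.choose)
  exact congrArg₂ ofSpineless (congrArg (fun D => D.rescale s hs) h'.1.symm) h'.2.symm

theorem glue_nested {k l m p q r : ℕ} (h₁ : k + l = p + 1) (h₂ : p + m = r + 1)
    (h₃ : l + m = q + 1) (h₄ : k + q = r + 1) (i : Fin k) (j : Fin l) (j' : Fin p)
    (hj : (j' : ℕ) = i + j) (a : Cactus k) (b : Cactus l) (c : Cactus m) :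
    (a.glue h₁ i b).glue h₂ j' c = a.glue h₄ i (b.glue h₃ j c) := by
  refine Cactus.ext ?_ (funext fun x => ?_)
  -- Radii compose exactly as for the underlying spineless cacti, so their identity is borrowed from
  -- there.
  · obtain ⟨A, -, hA, -⟩ := a.exists_zeros
    obtain ⟨B, -, hB, -⟩ := b.exists_zeros
    obtain ⟨C, -, hC, -⟩ := c.exists_zeros
    have h := congrArg SpinelessCactus.radius
      (SpinelessCactus.glue_nested h₁ h₂ h₃ h₄ i j j' hj A B C)
    simp only [SpinelessCactus.glue_radius, hA, hB, hC] at h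
    exact h
  · simp only [glue]
    rw [splice_apply_of_eq h₁ i j _ _ j' hj, splice_nested h₁ h₂ h₃ h₄ i j j' hj]

theorem glue_parallel {k l m p q r : ℕ} (h₁ : k + l = p + 1) (h₂ : p + m = r + 1)
    (h₃ : k + m = q + 1) (h₄ : q + l = r + 1) (i j : Fin k) (j' : Fin p) (i' : Fin q)
    (hji : j < i) (hj : (j' : ℕ) = j) (hi : (i' : ℕ) + 1 = i + m) (a : Cactus k)
    (b : Cactus l) (c : Cactus m) :
    (a.glue h₁ i b).glue h₂ j' c = (a.glue h₃ j c).glue h₄ i' b := by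
  refine Cactus.ext ?_ (funext fun x => ?_) <;>
  · simp only [glue]
    rw [splice_apply_of_lt h₁ i j _ _ j' hji hj, splice_apply_of_gt h₃ j i _ _ i' hji hi,
      splice_parallel h₁ h₂ h₃ h₄ i j j' i' hji hj hi]

end Cactus

/-! ### The isomorphisms with the bi-crossed products -/

/-- Cacti are isomorphic to the bi-crossed product of spineless cacti and circles. -/
noncomputable def cactiIso : QuasiOperadIso cactiComp (bicrossedComp cactTwist circlesTwist) where
  homeo n := (Cactus.homeo n).symm
  map_act n σ a := by
    refine ((Cactus.homeo n).symm_apply_eq).2 ?_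
    refine Eq.trans ?_ (Cactus.ofSpineless_smul σ _ _).symm
    exact congrArg (σ • ·) ((Cactus.homeo n).apply_symm_apply a).symm
  map_comp m n p h i a b := by
    refine ((Cactus.homeo p).symm_apply_eq).2 ?_
    refine Eq.trans ?_ (Cactus.ofSpineless_glue h i _ _ _ _)
    exact congrArg₂ (Cactus.glue h i) ((Cactus.homeo m).apply_symm_apply a).symm
      ((Cactus.homeo n).apply_symm_apply b).symm

theorem cactiIso_ofSpineless {n : ℕ} (C : SpinelessCactus n) (z : Fin n → UnitAddCircle) :
    cactiIso.homeo n (Cactus.ofSpineless C z) = (C, z) :=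
  (Cactus.homeo n).symm_apply_apply (C, z)

/-- Continuity and equivariance are transported from the bi-crossed product. Associativity is
checked on cacti themselves, where gluing is plain substitution of perimeters and no twist appears.
-/
theorem isOperad_cacti : IsOperad Cacti cactiComp where
  toIsQuasiOperad := cactiIso.isQuasiOperad (isQuasiOperad_bicrossed isOperad_cact.continuous_act
    isOperad_circles.continuous_act isLeftTwist_cactTwist isRightTwist_circlesTwist)
  assoc_nested _ _ _ _ _ _ h₁ h₂ h₃ h₄ i j j' hj a b c :=
    Cactus.glue_nested h₁ h₂ h₃ h₄ i j j' hj a b c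
  assoc_parallel _ _ _ _ _ _ h₁ h₂ h₃ h₄ i j j' i' hji hj hi a b c :=
    Cactus.glue_parallel h₁ h₂ h₃ h₄ i j j' i' hji hj hi a b c

/-- A normalized cactus is a normalized spineless cactus together with the coordinates of the local
zeros. -/
noncomputable def NormalizedCactus.homeo (n : ℕ) :
    NormalizedSpinelessCactus n × (Fin n → UnitAddCircle) ≃ₜ NormalizedCactus n where
  toFun q := ofSpineless q.1 q.2
  invFun c := (⟨((Cactus.homeo n).symm c.1).1, fun a => (congrFun (congrArg Cactus.radius
    ((Cactus.homeo n).apply_symm_apply c.1)) a).trans (c.2 a)⟩, ((Cactus.homeo n).symm c.1).2)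
  left_inv q := by
    have h := (Cactus.homeo n).symm_apply_apply (q.1.1, q.2)
    refine Prod.ext (Subtype.ext ?_) ?_
    · exact congrArg Prod.fst h
    · exact (congrArg Prod.snd h :)
  right_inv c := Subtype.ext ((Cactus.homeo n).apply_symm_apply c.1)
  continuous_toFun := continuous_induced_rng.2 ((Cactus.homeo n).continuous.comp
    (NormalizedSpinelessCactus.continuous_val.prodMap continuous_id))
  continuous_invFun := by
    have h : Continuous fun c : NormalizedCactus n => (Cactus.homeo n).symm c.1 :=
      (Cactus.homeo n).symm.continuous.comp continuous_induced_dom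
    exact (NormalizedSpinelessCactus.continuous_iff_val.2 h.fst).prodMk h.snd

theorem NormalizedCactus.ofSpineless_smul {n : ℕ} (σ : Equiv.Perm (Fin n))
    (C : NormalizedSpinelessCactus n) (z : Fin n → UnitAddCircle) :
    ofSpineless (σ • C) (fun b => z (σ⁻¹ b)) = σ • ofSpineless C z :=
  Subtype.ext (Cactus.ofSpineless_smul σ C.1 z)

theorem NormalizedCactus.ofSpineless_glue {m n p : ℕ} (h : m + n = p + 1) (i : Fin m)
    (C : NormalizedSpinelessCactus m) (z : Fin m → UnitAddCircle)
    (C' : NormalizedSpinelessCactus n) (z' : Fin n → UnitAddCircle) :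
    (ofSpineless C z).glue h i (ofSpineless C' z') =
      ofSpineless (C.glue h i (C'.rotate (z i)))
        (splice h i z (fun k => C'.1.diagonal (z i) k + z' k)) := by
  refine Subtype.ext ?_
  change ((Cactus.ofSpineless C.1 z).rescale _ _).glue h i (Cactus.ofSpineless C'.1 z') = _
  rw [Cactus.ofSpineless_rescale, Cactus.ofSpineless_glue]
  rfl

/-- Normalized cacti are isomorphic to the bi-crossed product of normalized spineless cacti and
circles. -/
noncomputable def ncactiIso :
    QuasiOperadIso ncactiComp (bicrossedComp ncactTwist ncirclesTwist) where
  homeo n := (NormalizedCactus.homeo n).symm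
  map_act n σ a := by
    refine ((NormalizedCactus.homeo n).symm_apply_eq).2 ?_
    refine Eq.trans ?_ (NormalizedCactus.ofSpineless_smul σ _ _).symm
    exact congrArg (σ • ·) ((NormalizedCactus.homeo n).apply_symm_apply a).symm
  map_comp m n p h i a b := by
    refine ((NormalizedCactus.homeo p).symm_apply_eq).2 ?_
    refine Eq.trans ?_ (NormalizedCactus.ofSpineless_glue h i _ _ _ _)
    exact congrArg₂ (NormalizedCactus.glue h i)
      ((NormalizedCactus.homeo m).apply_symm_apply a).symm
      ((NormalizedCactus.homeo n).apply_symm_apply b).symm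

theorem ncactiIso_ofSpineless {n : ℕ} (C : NormalizedSpinelessCactus n)
    (z : Fin n → UnitAddCircle) :
    ncactiIso.homeo n (NormalizedCactus.ofSpineless C z) = (C, z) :=
  (NormalizedCactus.homeo n).symm_apply_apply (C, z)

theorem isQuasiOperad_ncacti : IsQuasiOperad NCacti ncactiComp :=
  ncactiIso.isQuasiOperad (isQuasiOperad_bicrossed isQuasiOperad_ncact.continuous_act
    isOperad_circles.continuous_act isLeftTwist_ncactTwist isRightTwist_ncirclesTwist)

end CactusOperad

theorem theorem5p2p4 :
    -- the objects are (quasi-)operads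
    (IsOperad Cacti cactiComp ∧ IsOperad Cact cactComp ∧ IsOperad Circles circlesComp ∧
      IsQuasiOperad NCacti ncactiComp ∧ IsQuasiOperad NCact ncactComp) ∧
    -- the twisted compositions define bi-crossed and semi-direct products
    (IsBicrossedDatum cactComp circlesComp cactTwist circlesTwist ∧
      IsSemidirectDatum cactComp circlesComp cactTwist ∧
      IsBicrossedDatum ncactComp circlesComp ncactTwist ncirclesTwist ∧
      IsSemidirectDatum ncactComp circlesComp ncactTwist) ∧
    -- cacti are isomorphic to the bi-crossed product, by the underlying spineless cactus and the
    -- coordinates of the local zeros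
    (∃ Φ : QuasiOperadIso cactiComp (bicrossedComp cactTwist circlesTwist),
      ∀ (n : ℕ) (C : SpinelessCactus n) (z : Fin n → UnitAddCircle),
        Φ.homeo n (Cactus.ofSpineless C z) = (C, z)) ∧
    -- the bi-crossed product is homotopy equivalent to the semi-direct product
    HomotopyEquivalent (bicrossedComp cactTwist circlesTwist)
      (semidirectComp circlesComp cactTwist) ∧
    -- the same for normalized cacti
    (∃ Φ : QuasiOperadIso ncactiComp (bicrossedComp ncactTwist ncirclesTwist),
      ∀ (n : ℕ) (C : NormalizedSpinelessCactus n) (z : Fin n → UnitAddCircle),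
        Φ.homeo n (NormalizedCactus.ofSpineless C z) = (C, z)) ∧
    HomotopyEquivalent (bicrossedComp ncactTwist ncirclesTwist)
      (semidirectComp circlesComp ncactTwist) ∧
    -- the normalized bi-crossed product and the semi-direct product with all spineless cacti
    ∃ γ : Compositions (Cact.prod Circles),
      HomotopyEquivalent (semidirectComp circlesComp cactTwist) γ ∧
      HasEquivalence γ (bicrossedComp ncactTwist ncirclesTwist) := by
  exact ⟨⟨isOperad_cacti, isOperad_cact, isOperad_circles, isQuasiOperad_ncacti,
      isQuasiOperad_ncact⟩,
    ⟨isBicrossedDatum_cact, isSemidirectDatum_cact, isBicrossedDatum_ncact,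
      isSemidirectDatum_ncact⟩,
    ⟨cactiIso, fun _ => cactiIso_ofSpineless⟩, homotopyEquivalent_cact,
    ⟨ncactiIso, fun _ => ncactiIso_ofSpineless⟩, homotopyEquivalent_ncact,
    -- The compositions `γ` are the end of the shrinking homotopy, `bicrossedComp (shrinkTwist 1)
    -- (circlesShrinkTwist 1)`.
    _, homotopyEquivalent_shrink, hasEquivalence_shrink⟩
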